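/- Fix $d\ge 1$ and let $B_r(x)$ be the closed Euclidean ball of radius $r$ about $x$ in $\mathbb R^d$, $B_r=B_r(0)$. A tile is a subset of $\mathbb R^d$ homeomorphic to the closed unit ball; a tiling is a collection of tiles with pairwise disjoint interiors and union $\mathbb R^d$. For a collection $T$ of tiles put $T\sqcap F=\{t\in T: t\cap F\ne\varnothing\}$; $T_1,T_2$ match in $F$ if $T_1\sqcap F=T_2\sqcap F$. Let $\mathcal P$ be a finite set of punctured tiles: $0\in\operatorname{int}(p)$ for each $p\in\mathcal P$, and $p=v+q$ with $p,q\in\mathcal P$, $v\in\mathbb R^d$ implies $p=q$ and $v=0$. If $t=v+p$ with $p\in\mathcal P$, write $\operatorname{pos}(t)=v$. Let $\Omega_\circ(\mathcal P)$ be the set of tilings all of whose tiles are translates of elements of $\mathcal P$ and at least one of whose tiles belongs to $\mathcal P$, with the metric $d(T_1,T_2)=2^{-\sup\{r\ge 0:\ T_1\sqcap B_r=T_2\sqcap B_r\}}$ (equal to $0$ if $T_1=T_2$). Assume that $\mathcal P$ has finite local complexity: for each $r>0$ the set $\{T\sqcap B_r: T\in\Omega_\circ(\mathcal P)\}$ is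 finite. Let $\rho=\inf\{r>0: p\subset B_r \text{ for all } p\in\mathcal P\}$, and let $K,L$ be positive integers. The patch blueprint $\Gamma=\Gamma(\mathcal P,K,L)$ consists of: the states $M=\{T\sqcap B_{K\rho}: T\in\Omega_\circ(\mathcal P)\}$; the generators $S=\{(m,v)\in M\times\mathbb R^d: 0<\|v\|\le 3\rho,\ v=\operatorname{pos}(t)\text{ for some } t\in m\}$; for $s=(m,v)$ the initial state $\mathfrak i(s)=m$, the valuation $\operatorname{val}(s)=v$, and the set of final states $\mathfrak t(s)=\{m'\in M: m'+v \text{ matches with } m \text{ in } B_{K\rho}(0)\cap B_{K\rho}(v)\}$; and the set $R$ of relations, which are the pairs $(w,w')$ of nonempty words over $S$ with $|w|+|w'|\le L$, the same initial state (that of the first letter) and $\operatorname{val}(w)=\operatorname{val}(w')$, where $\operatorname{val}$ of a word is the sum of the valuations of its letters. A word $w_1\cdots w_n\in S^*$ is consistent if $\mathfrak i(w_{i+1})\in\mathfrak t(w_i)$ for $1\le i<n$. Two consistent words are similar if they are of the form $xwy$ and $xw'y$ with $x,y\in S^*$ and $(w,w')\in R$; equivalence of consistent words is the equivalence relation generated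 by similarity. A model of $\Gamma$ is a map $\varphi:S^*\to M\cup\{\varnothing\}$ (where $\varnothing$ is an extra symbol) with $\varphi(\varepsilon)\in M$ such that, for all $w\in S^*$ and $s\in S$, $\varphi(ws)\in\mathfrak t(s)$ if $\varphi(w)=\mathfrak i(s)$ and $\varphi(ws)=\varnothing$ otherwise, and such that $\varphi(u)=\varphi(v)$ for all equivalent $u,v$ with $\varphi(u)\neq\varnothing\neq\varphi(v)$. The set $\mathcal M(\Gamma)$ of models carries the topology induced by the product of the discrete topologies on $(M\cup\{\varnothing\})^{S^*}$. For $T\in\Omega_\circ(\mathcal P)$ define $\Psi(T):S^*\to M\cup\{\varnothing\}$ recursively: $\Psi(T)(\varepsilon)=T\sqcap B_{K\rho}$, and for $w\in S^*$, $s\in S$, $\Psi(T)(ws)=(T-\operatorname{val}(ws))\sqcap B_{K\rho}$ if $\Psi(T)(w)=\mathfrak i(s)$ and $T-\operatorname{val}(ws)\in\Omega_\circ(\mathcal P)$, and $\Psi(T)(ws)=\varnothing$ otherwise. Proposition. If $K\ge 117$ and $L\ge 2K+14$, then $\Psi$ is a homeomorphism from $\Omega_\circ(\mathcal P)$ onto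 $\mathcal M(\Gamma(\mathcal P,K,L))$. -/

import Mathlib

open scoped Pointwise

namespace GeomTiling

/-! ### Blueprints and their models -/

/-- A blueprint with set of states `M` and set of generators `S`: initial states `init`, nonempty
sets `term` of possible final states, and a set `rel` of pairs of words. (Non-emptiness of `M` and
`S` is not a field, so that the notion also covers the case of tiles that admit no tiling.) -/
structure Blueprint (M S : Type*) where
  init : S → M
  term : S → Set M
  term_nonempty : ∀ s, (term s).Nonempty
  rel : Set (List S × List S)

namespace Blueprint

variable {M S : Type*} (Γ : Blueprint M S)

/-- A word is consistent if each letter starts at a possible final state of the previous one. -/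
def ConsistentWord (w : List S) : Prop :=
  w.IsChain fun s s' => Γ.init s' ∈ Γ.term s

/-- Consistent words `u = x w y` and `v = x w' y`, with `(w, w')` a relation. -/
def Similar (u v : List S) : Prop :=
  Γ.ConsistentWord u ∧ Γ.ConsistentWord v ∧
    ∃ w w' x y : List S, (w, w') ∈ Γ.rel ∧ u = x ++ w ++ y ∧ v = x ++ w' ++ y

/-- The equivalence relation generated by similarity. -/
def Equivalent : List S → List S → Prop :=
  Relation.EqvGen Γ.Similar

/-- Consistent maps `φ : S* → M ∪ {∅}`; the symbol `∅` is `none`. -/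
def ConsistentMap (φ : List S → Option M) : Prop :=
  (∃ m, φ [] = some m) ∧
    ∀ (w : List S) (s : S),
      (φ w = some (Γ.init s) → ∃ m ∈ Γ.term s, φ (w ++ [s]) = some m) ∧
      (φ w ≠ some (Γ.init s) → φ (w ++ [s]) = none)

/-- A model is a consistent map which takes the same value on equivalent words of its support. -/
def IsModel (φ : List S → Option M) : Prop :=
  Γ.ConsistentMap φ ∧
    ∀ u v : List S, φ u ≠ none → φ v ≠ none → Γ.Equivalent u v → φ u = φ v

/-- The space of all models of `Γ`. -/
def ModelSpace : Type _ := {φ : List S → Option M // Γ.IsModel φ}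

/-- The topology induced by the product of the discrete topologies. -/
instance : TopologicalSpace Γ.ModelSpace :=
  TopologicalSpace.induced Subtype.val
    (@Pi.topologicalSpace (List S) (fun _ => Option M) (fun _ => ⊥))

end Blueprint

/-! ### Tilings -/

/-- The Euclidean space of dimension `d`. -/
abbrev Eu (d : ℕ) := EuclideanSpace ℝ (Fin d)

section Tilings

variable {d : ℕ}

/-- A tile is a subset homeomorphic to the closed unit ball. -/
def IsTile (t : Set (Eu d)) : Prop :=
  Nonempty (t ≃ₜ Metric.closedBall (0 : Eu d) 1)

/-- Collections of tiles with pairwise disjoint interiors. -/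
def IsPartialTiling (T : Set (Set (Eu d))) : Prop :=
  (∀ t ∈ T, IsTile t) ∧ T.PairwiseDisjoint interior

/-- Partial tilings whose support is the whole space. -/
def IsTiling (T : Set (Set (Eu d))) : Prop :=
  IsPartialTiling T ∧ ⋃₀ T = Set.univ

/-- The set `T ⊓ F` of all tiles of `T` that intersect `F`. -/
def meeting (T : Set (Set (Eu d))) (F : Set (Eu d)) : Set (Set (Eu d)) :=
  {t ∈ T | (t ∩ F).Nonempty}

/-- `T₁` and `T₂` match in `F`. -/
def Match (T₁ T₂ : Set (Set (Eu d))) (F : Set (Eu d)) : Prop :=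
  meeting T₁ F = meeting T₂ F

/-- Sets of punctured tiles: the origin is interior to each tile, and distinct tiles are not
translates of each other. -/
structure IsPuncturedTileSet (P : Set (Set (Eu d))) : Prop where
  isTile : ∀ p ∈ P, IsTile p
  zero_mem_interior : ∀ p ∈ P, (0 : Eu d) ∈ interior p
  eq_of_translate : ∀ p ∈ P, ∀ q ∈ P, ∀ v : Eu d, p = v +ᵥ q → p = q ∧ v = 0

/-- `v` is a position of the tile `t`, that is, `t = v + p` for some `p ∈ P`. When `P` is a set of
punctured tiles, there is at most one such `v`. -/
def IsPos (P : Set (Set (Eu d))) (t : Set (Eu d)) (v : Eu d) : Prop :=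
  ∃ p ∈ P, t = v +ᵥ p

/-- The tilings generated by `P`. -/
def tilings (P : Set (Set (Eu d))) : Set (Set (Set (Eu d))) :=
  {T | IsTiling T ∧ ∀ t ∈ T, ∃ v, IsPos P t v}

/-- The punctured tilings generated by `P`. -/
def puncturedTilings (P : Set (Set (Eu d))) : Set (Set (Set (Eu d))) :=
  {T | T ∈ tilings P ∧ ∃ t ∈ T, t ∈ P}

/-- Finite local complexity. -/
def FLC (P : Set (Set (Eu d))) : Prop :=
  ∀ r : ℝ, 0 < r →
    {m | ∃ T ∈ puncturedTilings P, m = meeting T (Metric.closedBall 0 r)}.Finite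

/-- The space of punctured tilings. -/
def PuncturedTilingSpace (P : Set (Set (Eu d))) : Type :=
  {T : Set (Set (Eu d)) // T ∈ puncturedTilings P}

/-- The radii `r ≥ 0` such that `T₁` and `T₂` match in the closed ball of radius `r`. -/
def matchRadii (T₁ T₂ : Set (Set (Eu d))) : Set ℝ :=
  {r | 0 ≤ r ∧ Match T₁ T₂ (Metric.closedBall 0 r)}

open Classical in
/-- The distance `2 ^ (-sup r)` over all `r ≥ 0` such that the tilings match in the closed ball of
radius `r`; it is `0` for equal tilings, when the supremum is infinite. -/
noncomputable def tilingDist (T₁ T₂ : Set (Set (Eu d))) : ℝ :=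
  if T₁ = T₂ then 0 else (2 : ℝ) ^ (-sSup (matchRadii T₁ T₂))

theorem IsTile.nonempty {t : Set (Eu d)} (h : IsTile t) : t.Nonempty := by
  obtain ⟨e⟩ := h
  exact ⟨_, (e.symm ⟨0, by simp⟩).2⟩

theorem Match.mono {T₁ T₂ : Set (Set (Eu d))} {F G : Set (Eu d)} (h : Match T₁ T₂ G)
    (hFG : F ⊆ G) : Match T₁ T₂ F := by
  have key : ∀ T : Set (Set (Eu d)), meeting T F = meeting (meeting T G) F := by
    intro T
    ext t
    constructor
    · rintro ⟨ht, x, hx, hxF⟩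
      exact ⟨⟨ht, x, hx, hFG hxF⟩, x, hx, hxF⟩
    · rintro ⟨⟨ht, -⟩, hF⟩
      exact ⟨ht, hF⟩
  unfold Match at h ⊢
  rw [key T₁, key T₂, h]

theorem matchRadii_comm (T₁ T₂ : Set (Set (Eu d))) : matchRadii T₁ T₂ = matchRadii T₂ T₁ := by
  ext r
  exact ⟨fun h => ⟨h.1, h.2.symm⟩, fun h => ⟨h.1, h.2.symm⟩⟩

theorem matchRadii_lt {T₁ T₂ : Set (Set (Eu d))} {t : Set (Eu d)} {x : Eu d} (h₁ : t ∈ T₁)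
    (h₂ : t ∉ T₂) (hx : x ∈ t) {r : ℝ} (hr : r ∈ matchRadii T₁ T₂) : r < ‖x‖ := by
  by_contra! hlt
  have : t ∈ meeting T₁ (Metric.closedBall 0 r) := ⟨h₁, x, hx, by simpa using hlt⟩
  rw [hr.2] at this
  exact h₂ this.1

theorem bddAbove_matchRadii {T₁ T₂ : Set (Set (Eu d))} (h₁ : ∀ t ∈ T₁, IsTile t)
    (h₂ : ∀ t ∈ T₂, IsTile t) (hne : T₁ ≠ T₂) : BddAbove (matchRadii T₁ T₂) := by
  have : ∃ t, (t ∈ T₁ ∧ t ∉ T₂) ∨ (t ∈ T₂ ∧ t ∉ T₁) := by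
    by_contra! hcon
    exact hne (Set.ext fun t => ⟨(hcon t).1, (hcon t).2⟩)
  obtain ⟨t, ⟨ht, ht'⟩ | ⟨ht, ht'⟩⟩ := this
  · obtain ⟨x, hx⟩ := (h₁ t ht).nonempty
    exact ⟨‖x‖, fun r hr => (matchRadii_lt ht ht' hx hr).le⟩
  · obtain ⟨x, hx⟩ := (h₂ t ht).nonempty
    refine ⟨‖x‖, fun r hr => ?_⟩
    rw [matchRadii_comm] at hr
    exact (matchRadii_lt ht ht' hx hr).le

theorem mem_matchRadii_of_lt {T₁ T₂ : Set (Set (Eu d))} {r : ℝ} (hr : 0 ≤ r)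
    (h : r < sSup (matchRadii T₁ T₂)) : r ∈ matchRadii T₁ T₂ := by
  have hne : (matchRadii T₁ T₂).Nonempty := by
    by_contra hemp
    rw [Set.not_nonempty_iff_eq_empty] at hemp
    rw [hemp, Real.sSup_empty] at h
    linarith
  obtain ⟨s, hs, hrs⟩ := exists_lt_of_lt_csSup hne h
  exact ⟨hr, hs.2.mono (Metric.closedBall_subset_closedBall hrs.le)⟩

theorem sSup_matchRadii_nonneg (T₁ T₂ : Set (Set (Eu d))) : 0 ≤ sSup (matchRadii T₁ T₂) :=
  Real.sSup_nonneg fun _ h => h.1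

theorem tilingDist_nonneg (T₁ T₂ : Set (Set (Eu d))) : 0 ≤ tilingDist T₁ T₂ := by
  unfold tilingDist
  split_ifs
  · exact le_rfl
  · positivity

theorem tilingDist_triangle {T₁ T₂ T₃ : Set (Set (Eu d))} (h₁ : ∀ t ∈ T₁, IsTile t)
    (h₃ : ∀ t ∈ T₃, IsTile t) :
    tilingDist T₁ T₃ ≤ tilingDist T₁ T₂ + tilingDist T₂ T₃ := by
  by_cases h13 : T₁ = T₃
  · have : tilingDist T₁ T₃ = 0 := by simp [tilingDist, h13]
    rw [this]
    exact add_nonneg (tilingDist_nonneg _ _) (tilingDist_nonneg _ _)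
  by_cases h12 : T₁ = T₂
  · subst h12
    simp [tilingDist]
  by_cases h23 : T₂ = T₃
  · subst h23
    simp [tilingDist]
  have key : min (sSup (matchRadii T₁ T₂)) (sSup (matchRadii T₂ T₃)) ≤
      sSup (matchRadii T₁ T₃) := by
    by_contra! hlt
    obtain ⟨r, hr, hr'⟩ := exists_between hlt
    have hr0 : 0 ≤ r := (sSup_matchRadii_nonneg _ _).trans hr.le
    have ha := mem_matchRadii_of_lt hr0 (hr'.trans_le (min_le_left _ _))
    have hb := mem_matchRadii_of_lt hr0 (hr'.trans_le (min_le_right _ _))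
    have hc : r ∈ matchRadii T₁ T₃ := ⟨hr0, ha.2.trans hb.2⟩
    exact absurd (le_csSup (bddAbove_matchRadii h₁ h₃ h13) hc) (not_le.mpr hr)
  simp only [tilingDist, h13, h12, h23, if_false]
  have pa : (0 : ℝ) < 2 ^ (-sSup (matchRadii T₁ T₂)) := by positivity
  have pb : (0 : ℝ) < 2 ^ (-sSup (matchRadii T₂ T₃)) := by positivity
  rcases min_le_iff.mp key with h | h
  · have := Real.rpow_le_rpow_of_exponent_le (x := 2) (by norm_num) (neg_le_neg h)
    linarith
  · have := Real.rpow_le_rpow_of_exponent_le (x := 2) (by norm_num) (neg_le_neg h)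
    linarith

/-- The metric of the space of punctured tilings. -/
noncomputable instance (P : Set (Set (Eu d))) : MetricSpace (PuncturedTilingSpace P) where
  dist T₁ T₂ := tilingDist T₁.1 T₂.1
  dist_self T := by simp [tilingDist]
  dist_comm T₁ T₂ := by
    simp only [tilingDist, matchRadii_comm T₁.1 T₂.1, eq_comm (a := T₁.1)]
  dist_triangle T₁ T₂ T₃ := tilingDist_triangle T₁.2.1.1.1.1 T₃.2.1.1.1.1
  eq_of_dist_eq_zero := by
    intro T₁ T₂ h
    by_contra hne
    have hne' : T₁.1 ≠ T₂.1 := fun h' => hne (Subtype.ext h')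
    have h' : tilingDist T₁.1 T₂.1 = 0 := h
    rw [tilingDist, if_neg hne'] at h'
    exact (Real.rpow_pos_of_pos (by norm_num : (0 : ℝ) < 2) _).ne' h'

/-! ### The patch blueprint -/

/-- The radius of the smallest closed ball centered at the origin that contains all tiles. -/
noncomputable def tileRadius (P : Set (Set (Eu d))) : ℝ :=
  sInf {r : ℝ | 0 < r ∧ ∀ p ∈ P, p ⊆ Metric.closedBall 0 r}

/-- The closed ball of center `x` and radius `K ρ`. -/
def patchBall (P : Set (Set (Eu d))) (K : ℕ) (x : Eu d) : Set (Eu d) :=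
  Metric.closedBall x (K * tileRadius P)

/-- The states: the patches of radius `K ρ` around the origin. -/
def PatchState (P : Set (Set (Eu d))) (K : ℕ) : Type :=
  {m : Set (Set (Eu d)) // ∃ T ∈ puncturedTilings P, m = meeting T (patchBall P K 0)}

/-- The generators: a patch `m` together with the position `v` of some tile of `m`, where
`0 < ‖v‖ ≤ 3 ρ`. -/
def PatchGen (P : Set (Set (Eu d))) (K : ℕ) : Type :=
  {s : PatchState P K × Eu d //
    0 < ‖s.2‖ ∧ ‖s.2‖ ≤ 3 * tileRadius P ∧ ∃ t ∈ s.1.1, IsPos P t s.2}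

/-- The valuation of a generator. -/
def PatchGen.val {P : Set (Set (Eu d))} {K : ℕ} (s : PatchGen P K) : Eu d := s.1.2

/-- The valuation of a word. -/
def wordVal {P : Set (Set (Eu d))} {K : ℕ} (w : List (PatchGen P K)) : Eu d :=
  (w.map PatchGen.val).sum

theorem IsTile.vadd {t : Set (Eu d)} (h : IsTile t) (v : Eu d) : IsTile (v +ᵥ t) := by
  obtain ⟨e⟩ := h
  exact ⟨((Homeomorph.vadd v).image t).symm.trans e⟩

theorem vadd_mem_puncturedTilings {P T : Set (Set (Eu d))} (hT : T ∈ tilings P)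
    {t : Set (Eu d)} (ht : t ∈ T) {v : Eu d} (hv : IsPos P t v) :
    -v +ᵥ T ∈ puncturedTilings P := by
  obtain ⟨⟨⟨htile, hdisj⟩, hcov⟩, hgen⟩ := hT
  refine ⟨⟨⟨⟨?_, ?_⟩, ?_⟩, ?_⟩, ?_⟩
  · rintro _ ⟨a, ha, rfl⟩
    exact (htile a ha).vadd _
  · rintro _ ⟨a, ha, rfl⟩ _ ⟨b, hb, rfl⟩ hab
    have hne : a ≠ b := fun h => hab (by rw [h])
    have := hdisj ha hb hne
    simp only [Function.onFun] at this ⊢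
    rw [interior_vadd, interior_vadd]
    rw [Set.disjoint_left] at this ⊢
    rintro _ ⟨x, hx, rfl⟩ ⟨y, hy, hxy⟩
    have hyx : y = x := by simpa using hxy
    exact this hx (hyx ▸ hy)
  · refine Set.eq_univ_of_forall fun x => ?_
    have hx : v + x ∈ ⋃₀ T := hcov ▸ Set.mem_univ _
    obtain ⟨a, ha, hxa⟩ := hx
    exact ⟨-v +ᵥ a, ⟨a, ha, rfl⟩, v + x, hxa, by simp⟩
  · rintro _ ⟨a, ha, rfl⟩
    obtain ⟨u, p, hp, rfl⟩ := hgen a ha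
    exact ⟨-v + u, p, hp, (vadd_vadd _ _ _)⟩
  · obtain ⟨p, hp, rfl⟩ := hv
    refine ⟨p, ⟨_, ht, ?_⟩, hp⟩
    simp

theorem vadd_meeting (v : Eu d) (T : Set (Set (Eu d))) (F : Set (Eu d)) :
    v +ᵥ meeting T F = meeting (v +ᵥ T) (v +ᵥ F) := by
  ext t
  constructor
  · rintro ⟨a, ⟨ha, x, hxa, hxF⟩, rfl⟩
    exact ⟨⟨a, ha, rfl⟩, v +ᵥ x, ⟨x, hxa, rfl⟩, ⟨x, hxF, rfl⟩⟩
  · rintro ⟨⟨a, ha, rfl⟩, y, ⟨x, hxa, rfl⟩, ⟨x', hxF, hxx'⟩⟩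
    have : x' = x := by simpa using hxx'
    subst this
    exact ⟨a, ⟨ha, x', hxa, hxF⟩, rfl⟩

theorem meeting_meeting {T : Set (Set (Eu d))} {F G : Set (Eu d)} (h : F ⊆ G) :
    meeting (meeting T G) F = meeting T F := by
  ext t
  constructor
  · rintro ⟨⟨ht, -⟩, hF⟩
    exact ⟨ht, hF⟩
  · rintro ⟨ht, x, hx, hxF⟩
    exact ⟨⟨ht, x, hx, h hxF⟩, x, hx, hxF⟩

/-- The final states of a generator `(m, v)`: the patches `m'` such that `m' + v` matches with `m`
in the intersection of the two balls of radius `K ρ`. -/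
def patchTerm (P : Set (Set (Eu d))) (K : ℕ) (s : PatchGen P K) : Set (PatchState P K) :=
  {m' | Match (s.val +ᵥ m'.1) s.1.1.1 (patchBall P K 0 ∩ patchBall P K s.val)}

theorem patchTerm_nonempty (P : Set (Set (Eu d))) (K : ℕ) (s : PatchGen P K) :
    (patchTerm P K s).Nonempty := by
  obtain ⟨⟨⟨m, T, hT, rfl⟩, v⟩, hv0, hv3, t, ht, hpos⟩ := s
  refine ⟨⟨meeting (-v +ᵥ T) (patchBall P K 0), -v +ᵥ T,
    vadd_mem_puncturedTilings hT.1 ht.1 hpos, rfl⟩, ?_⟩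
  have hb : v +ᵥ patchBall P K (0 : Eu d) = patchBall P K v := by
    simp [patchBall]
  change meeting (v +ᵥ meeting (-v +ᵥ T) (patchBall P K 0)) (patchBall P K 0 ∩ patchBall P K v) =
    meeting (meeting T (patchBall P K 0)) (patchBall P K 0 ∩ patchBall P K v)
  rw [vadd_meeting, vadd_neg_vadd, hb, meeting_meeting Set.inter_subset_right,
    meeting_meeting Set.inter_subset_left]

/-- The patch blueprint `Γ(P, K, L)`. The relations are the pairs of (nonempty) words with total
length at most `L`, the same initial state (that of the first letter) and the same valuation. -/
def patchBlueprint (P : Set (Set (Eu d))) (K L : ℕ) :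
    Blueprint (PatchState P K) (PatchGen P K) where
  init s := s.1.1
  term := patchTerm P K
  term_nonempty := patchTerm_nonempty P K
  rel := {ww | ww.1.length + ww.2.length ≤ L ∧
    (∃ s u s' u', ww.1 = s :: u ∧ ww.2 = s' :: u' ∧ s.1.1 = s'.1.1) ∧
    wordVal ww.1 = wordVal ww.2}

/-! ### The map from punctured tilings to models -/

open Classical in
/-- The map `Ψ`, by recursion on words: the empty word is sent to the patch of `T` around the
origin; if `w` is sent to the initial state of `s` and `T - val (ws)` is a punctured tiling, then
`ws` is sent to the patch around the origin of `T - val (ws)`, and otherwise to `∅`. -/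
noncomputable def Psi (P : Set (Set (Eu d))) (K : ℕ) (T : PuncturedTilingSpace P)
    (w : List (PatchGen P K)) : Option (PatchState P K) :=
  w.reverseRecOn (some ⟨meeting T.1 (patchBall P K 0), T.1, T.2, rfl⟩)
    fun w s prev =>
      if h : prev = some s.1.1 ∧ -wordVal (w ++ [s]) +ᵥ T.1 ∈ puncturedTilings P then
        some ⟨meeting (-wordVal (w ++ [s]) +ᵥ T.1) (patchBall P K 0), _, h.2, rfl⟩
      else none

theorem Psi_nil (P : Set (Set (Eu d))) (K : ℕ) (T : PuncturedTilingSpace P) :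
    Psi P K T [] = some ⟨meeting T.1 (patchBall P K 0), T.1, T.2, rfl⟩ := by
  simp [Psi]

open Classical in
theorem Psi_concat (P : Set (Set (Eu d))) (K : ℕ) (T : PuncturedTilingSpace P)
    (w : List (PatchGen P K)) (s : PatchGen P K) :
    Psi P K T (w ++ [s]) =
      if h : Psi P K T w = some s.1.1 ∧ -wordVal (w ++ [s]) +ᵥ T.1 ∈ puncturedTilings P then
        some ⟨meeting (-wordVal (w ++ [s]) +ᵥ T.1) (patchBall P K 0), _, h.2, rfl⟩
      else none := by
  simp only [Psi]
  rw [List.reverseRecOn_concat]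
  rfl

end Tilings

end GeomTiling

namespace GeomTiling

variable {d : ℕ} {P : Set (Set (Eu d))} {K L : ℕ}

/-! ### Geometry of the tiles -/

/-! Translating the value of a map φ at a word w by val(w) gives the absolute patch `absPatch φ w`.
For Ψ(T) these are patches of T itself, and equivalent words have equal valuations, so Ψ(T) is a
model. The substance is surjectivity: for an arbitrary model, absolute patches must be shown to
depend on the endpoint of a word only, not on its path.

This is a monodromy argument. Locally, relations of total length at most 4 make short loops act
trivially (`interchangeable_append_loop`), so that adjacency of words is symmetric, and transitive
as long as the ends stay within 3ρ (`adjacent_symm`, `adjacent_trans`). Globally, ℝ^d is star-shaped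
about the origin: every point is the end of a chain of short steps along its ray, and a ladder of
small quadrilaterals shows that chains along neighbouring rays end at adjacent words
(`adjacent_of_follows`). By induction on letters, every word in the support is adjacent to the
chains along the ray to its endpoint (`exists_adjacentToRay`). Hence words with close valuations are
adjacent (`adjacent_of_dist_le`), absolute patches agree on overlaps (`mem_absPatch_of_mem`), and
their union is a tiling which Ψ sends back to φ (`Psi_tiling`). All this works as soon as K ≥ 6 and
L ≥ 4.

As for topology, the value of Ψ(T) at a word depends only on T in a large ball
(`Psi_congr_of_match`). Conversely, the values at finitely many words whose valuations are ρ-close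
to a net of a ball determine T in that ball (`eventually_match`); this gives both injectivity and
continuity of the inverse. -/

theorem subset_closedBall_tileRadius (hfin : P.Finite) (hP : IsPuncturedTileSet P)
    {p : Set (Eu d)} (hp : p ∈ P) : p ⊆ Metric.closedBall 0 (tileRadius P) := by
  have hbdd : Bornology.IsBounded (⋃₀ P) := by
    refine (Bornology.isBounded_sUnion hfin).2 fun q hq => ?_
    obtain ⟨e⟩ := hP.isTile q hq
    have : CompactSpace (Metric.closedBall (0 : Eu d) 1) :=
      isCompact_iff_compactSpace.1 (isCompact_closedBall _ _)
    have : CompactSpace q := e.symm.compactSpace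
    exact (isCompact_iff_compactSpace.2 inferInstance).isBounded
  obtain ⟨R, hR0, hR⟩ := hbdd.subset_closedBall_lt 0 (0 : Eu d)
  intro x hx
  rw [mem_closedBall_zero_iff]
  -- The witness R matters: the infimum of an empty set of reals would be the default value 0.
  refine le_csInf ⟨R, hR0, fun q hq => (Set.subset_sUnion_of_mem hq).trans hR⟩ ?_
  rintro r ⟨-, hr⟩
  exact mem_closedBall_zero_iff.1 (hr p hp hx)

theorem tileRadius_pos (hd : 1 ≤ d) (hfin : P.Finite) (hP : IsPuncturedTileSet P)
    (hne : P.Nonempty) : 0 < tileRadius P := by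
  obtain ⟨p, hp⟩ := hne
  obtain ⟨ε, hε, hball⟩ := Metric.isOpen_iff.1 isOpen_interior 0 (hP.zero_mem_interior p hp)
  have : Nonempty (Fin d) := ⟨⟨0, hd⟩⟩
  obtain ⟨x, hx⟩ := exists_norm_eq (Eu d) (half_pos hε).le
  have hxp : x ∈ p := interior_subset (hball (by simpa [hx] using half_lt_self hε))
  have := mem_closedBall_zero_iff.1 (subset_closedBall_tileRadius hfin hP hp hxp)
  linarith [half_pos hε]

theorem PuncturedTilingSpace.nonempty_tileSet (T : PuncturedTilingSpace P) : P.Nonempty := by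
  obtain ⟨t, -, ht⟩ := T.2.2
  exact ⟨t, ht⟩

theorem vadd_mem_tilings {T : Set (Set (Eu d))} (hT : T ∈ tilings P) (v : Eu d) :
    v +ᵥ T ∈ tilings P := by
  obtain ⟨⟨⟨htile, hdisj⟩, hcov⟩, hgen⟩ := hT
  refine ⟨⟨⟨?_, ?_⟩, ?_⟩, ?_⟩
  · rintro _ ⟨a, ha, rfl⟩
    exact (htile a ha).vadd _
  · rintro _ ⟨a, ha, rfl⟩ _ ⟨b, hb, rfl⟩ hab
    have hne : a ≠ b := fun h => hab (by rw [h])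
    change Disjoint (interior (v +ᵥ a)) (interior (v +ᵥ b))
    rw [interior_vadd, interior_vadd]
    exact Set.disjoint_vadd_set.2 (hdisj ha hb hne)
  · refine Set.eq_univ_of_forall fun x => ?_
    obtain ⟨a, ha, hxa⟩ : -v + x ∈ ⋃₀ T := hcov ▸ Set.mem_univ _
    exact ⟨v +ᵥ a, ⟨a, ha, rfl⟩, -v + x, hxa, by simp⟩
  · rintro _ ⟨a, ha, rfl⟩
    obtain ⟨u, p, hp, rfl⟩ := hgen a ha
    exact ⟨v + u, p, hp, vadd_vadd _ _ _⟩

theorem wordVal_append (u v : List (PatchGen P K)) :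
    wordVal (u ++ v) = wordVal u + wordVal v := by
  simp [wordVal]

theorem wordVal_nil : wordVal ([] : List (PatchGen P K)) = 0 := rfl

theorem wordVal_singleton (s : PatchGen P K) : wordVal [s] = s.val := by
  simp [wordVal]

/-! ### Supports of models -/

/-- The absolute patch of a map from words to patches at a word `w`: the value at `w`, translated
by the valuation of `w`, or the empty patch outside of the support. -/
def absPatch (φ : List (PatchGen P K) → Option (PatchState P K)) (w : List (PatchGen P K)) :
    Set (Set (Eu d)) :=
  {t | ∃ m, φ w = some m ∧ -wordVal w +ᵥ t ∈ m.1}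

/-- A model of a patch blueprint of sufficiently large parameters, with the geometric properties of
the set of tiles. -/
structure IsPatchModel (P : Set (Set (Eu d))) (K L : ℕ)
    (φ : List (PatchGen P K) → Option (PatchState P K)) : Prop where
  one_le_dim : 1 ≤ d
  radius_pos : 0 < tileRadius P
  subset_ball : ∀ p ∈ P, p ⊆ Metric.closedBall 0 (tileRadius P)
  zero_mem : ∀ p ∈ P, (0 : Eu d) ∈ p
  six_le : 6 ≤ K
  four_le : 4 ≤ L
  isModel : (patchBlueprint P K L).IsModel φ

theorem isPatchModel (hd : 1 ≤ d) (hfin : P.Finite) (hP : IsPuncturedTileSet P)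
    (hK : 6 ≤ K) (hL : 4 ≤ L) {φ : List (PatchGen P K) → Option (PatchState P K)}
    (hφ : (patchBlueprint P K L).IsModel φ) : IsPatchModel P K L φ := by
  refine ⟨hd, tileRadius_pos hd hfin hP ?_, fun p hp => subset_closedBall_tileRadius hfin hP hp,
    fun p hp => interior_subset (hP.zero_mem_interior p hp), hK, hL, hφ⟩
  obtain ⟨⟨⟨m, T, hT, -⟩, -⟩, -⟩ := hφ.1
  exact PuncturedTilingSpace.nonempty_tileSet ⟨T, hT⟩

namespace IsPatchModel

variable {φ : List (PatchGen P K) → Option (PatchState P K)}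

theorem six_mul_le (h : IsPatchModel P K L φ) : 6 * tileRadius P ≤ K * tileRadius P :=
  mul_le_mul_of_nonneg_right (by exact_mod_cast h.six_le) h.radius_pos.le

theorem dist_le_of_isPos (h : IsPatchModel P K L φ) {t : Set (Eu d)} {u x : Eu d}
    (hu : IsPos P t u) (hx : x ∈ t) : dist x u ≤ tileRadius P := by
  obtain ⟨p, hp, rfl⟩ := hu
  obtain ⟨y, hy, rfl⟩ := hx
  simpa using h.subset_ball p hp hy

theorem mem_of_isPos (h : IsPatchModel P K L φ) {t : Set (Eu d)} {u : Eu d}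
    (hu : IsPos P t u) : u ∈ t := by
  obtain ⟨p, hp, rfl⟩ := hu
  exact ⟨0, h.zero_mem p hp, by simp⟩

theorem nil_ne_none (h : IsPatchModel P K L φ) : φ [] ≠ none := by
  obtain ⟨⟨⟨m, hm⟩, -⟩, -⟩ := h.isModel
  simp [hm]

theorem eq_init (h : IsPatchModel P K L φ) {w : List (PatchGen P K)} {s : PatchGen P K}
    (hs : φ (w ++ [s]) ≠ none) : φ w = some s.1.1 := by
  by_contra hne
  exact hs ((h.isModel.1.2 w s).2 hne)

theorem concat_ne_none (h : IsPatchModel P K L φ) {w : List (PatchGen P K)} {s : PatchGen P K}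
    (hs : φ w = some s.1.1) : φ (w ++ [s]) ≠ none := by
  obtain ⟨m, -, hm⟩ := (h.isModel.1.2 w s).1 hs
  simp [hm]

/-- The symbol ∅ is never an initial state, hence it is absorbing: the support of a model is closed
under prefixes. -/
theorem append_eq_none (h : IsPatchModel P K L φ) {w : List (PatchGen P K)} (hw : φ w = none)
    (y : List (PatchGen P K)) : φ (w ++ y) = none := by
  induction y using List.reverseRecOn with
  | nil => simpa using hw
  | append_singleton y s ih =>
    rw [← List.append_assoc]
    exact (h.isModel.1.2 _ s).2 (by rw [ih]; simp)

theorem ne_none_of_append (h : IsPatchModel P K L φ) {w y : List (PatchGen P K)}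
    (hw : φ (w ++ y) ≠ none) : φ w ≠ none := fun h' => hw (h.append_eq_none h' y)

theorem eq_init_of_cons (h : IsPatchModel P K L φ) {w y : List (PatchGen P K)} {s : PatchGen P K}
    (hw : φ (w ++ s :: y) ≠ none) : φ w = some s.1.1 := by
  refine h.eq_init (h.ne_none_of_append (y := y) ?_)
  simpa using hw

theorem mem_term (h : IsPatchModel P K L φ) {w : List (PatchGen P K)} {s : PatchGen P K}
    {m : PatchState P K} (hs : φ (w ++ [s]) = some m) : m ∈ patchTerm P K s := by
  obtain ⟨m', hm', he⟩ := (h.isModel.1.2 w s).1 (h.eq_init (by simp [hs]))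
  rw [hs] at he
  cases he
  exact hm'

/-- Similarity is defined between consistent words only, so this is needed before any relation can
be applied to words of the support. -/
theorem consistentWord (h : IsPatchModel P K L φ) {w : List (PatchGen P K)} (hw : φ w ≠ none) :
    (patchBlueprint P K L).ConsistentWord w := by
  induction w using List.reverseRecOn with
  | nil => exact List.isChain_nil
  | append_singleton w s ih =>
    have hw' := h.ne_none_of_append hw
    refine List.isChain_append.2 ⟨ih hw', List.isChain_singleton _, ?_⟩
    intro x hx y hy
    obtain rfl : s = y := by simpa using hy
    obtain ⟨w', rfl⟩ := List.getLast?_eq_some_iff.1 hx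
    exact h.mem_term (h.eq_init hw)

/-! ### Absolute patches -/

theorem mem_absPatch_iff {w : List (PatchGen P K)} {m : PatchState P K} (hw : φ w = some m)
    {t : Set (Eu d)} : t ∈ absPatch φ w ↔ -wordVal w +ᵥ t ∈ m.1 := by
  simp [absPatch, hw]

theorem absPatch_eq {w : List (PatchGen P K)} {T : Set (Set (Eu d))}
    {hT : ∃ T' ∈ puncturedTilings P, meeting T (patchBall P K 0) = meeting T' (patchBall P K 0)}
    (hw : φ w = some ⟨meeting T (patchBall P K 0), hT⟩) :
    absPatch φ w = meeting (wordVal w +ᵥ T) (patchBall P K (wordVal w)) := by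
  have hb : wordVal w +ᵥ patchBall P K (0 : Eu d) = patchBall P K (wordVal w) := by
    simp [patchBall]
  rw [← hb, ← vadd_meeting]
  ext t
  rw [mem_absPatch_iff hw, Set.mem_vadd_set_iff_neg_vadd_mem]

theorem ne_none_of_mem_absPatch {w : List (PatchGen P K)}
    {t : Set (Eu d)} (ht : t ∈ absPatch φ w) : φ w ≠ none := by
  obtain ⟨m, hm, -⟩ := ht
  simp [hm]

/-- This is purely local: T depends on w, and nothing yet relates the tilings chosen for different
words. -/
theorem exists_tiling {w : List (PatchGen P K)} (hw : φ w ≠ none) :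
    ∃ T ∈ tilings P, (∃ t ∈ T, IsPos P t (wordVal w)) ∧
      absPatch φ w = meeting T (patchBall P K (wordVal w)) := by
  obtain ⟨⟨m, T, hT, rfl⟩, hm⟩ := Option.ne_none_iff_exists'.1 hw
  obtain ⟨p, hpT, hp⟩ := hT.2
  refine ⟨wordVal w +ᵥ T, vadd_mem_tilings hT.1 _, ⟨_, ⟨p, hpT, rfl⟩, p, hp, rfl⟩, absPatch_eq hm⟩

theorem exists_mem_absPatch {w : List (PatchGen P K)} (hw : φ w ≠ none)
    {y : Eu d} (hy : dist y (wordVal w) ≤ K * tileRadius P) : ∃ t ∈ absPatch φ w, y ∈ t := by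
  obtain ⟨T, hT, -, hA⟩ := exists_tiling hw
  obtain ⟨t, ht, hyt⟩ : y ∈ ⋃₀ T := hT.1.2 ▸ Set.mem_univ y
  exact ⟨t, hA ▸ ⟨ht, y, hyt, hy⟩, hyt⟩

theorem exists_meet_of_mem_absPatch {w : List (PatchGen P K)}
    {t : Set (Eu d)} (ht : t ∈ absPatch φ w) :
    ∃ y ∈ t, dist y (wordVal w) ≤ K * tileRadius P := by
  obtain ⟨T, -, -, hA⟩ := exists_tiling (ne_none_of_mem_absPatch ht)
  rw [hA] at ht
  obtain ⟨-, y, hyt, hy⟩ := ht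
  exact ⟨y, hyt, hy⟩

theorem exists_isPos_of_mem_absPatch {w : List (PatchGen P K)}
    {t : Set (Eu d)} (ht : t ∈ absPatch φ w) : ∃ u, IsPos P t u := by
  obtain ⟨T, hT, -, hA⟩ := exists_tiling (ne_none_of_mem_absPatch ht)
  rw [hA] at ht
  exact hT.2 t ht.1

theorem exists_central_tile (h : IsPatchModel P K L φ) {w : List (PatchGen P K)} (hw : φ w ≠ none) :
    ∃ t ∈ absPatch φ w, IsPos P t (wordVal w) := by
  obtain ⟨T, -, ⟨t, ht, hpos⟩, hA⟩ := exists_tiling hw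
  have := h.radius_pos
  refine ⟨t, hA ▸ ⟨ht, wordVal w, h.mem_of_isPos hpos, ?_⟩, hpos⟩
  exact Metric.mem_closedBall_self (by positivity)

theorem isPartialTiling_absPatch {w : List (PatchGen P K)}
    (hw : φ w ≠ none) : IsPartialTiling (absPatch φ w) := by
  obtain ⟨T, hT, -, hA⟩ := exists_tiling hw
  rw [hA]
  exact ⟨fun t ht => hT.1.1.1 t ht.1, hT.1.1.2.subset fun t ht => ht.1⟩

/-- Every nearby tile of an absolute patch, other than the central one, is reached by a letter. -/
theorem exists_letter (h : IsPatchModel P K L φ) {w : List (PatchGen P K)} {t : Set (Eu d)}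
    {u : Eu d} (ht : t ∈ absPatch φ w) (hu : IsPos P t u) (hne : u ≠ wordVal w)
    (hle : dist u (wordVal w) ≤ 3 * tileRadius P) :
    ∃ s, φ (w ++ [s]) ≠ none ∧ wordVal w + s.val = u := by
  obtain ⟨m, hm, htm⟩ := ht
  have hpos : ∃ t ∈ m.1, IsPos P t (u - wordVal w) := by
    obtain ⟨p, hp, rfl⟩ := hu
    exact ⟨_, htm, p, hp, by rw [vadd_vadd, sub_eq_neg_add]⟩
  let s : PatchGen P K :=
    ⟨(m, u - wordVal w), norm_pos_iff.2 (sub_ne_zero.2 hne), by rwa [← dist_eq_norm], hpos⟩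
  exact ⟨s, h.concat_ne_none (s := s) hm, add_sub_cancel (wordVal w) u⟩

/-- The absolute patches at a word and at its extension by a letter match in the intersection of
the two balls. -/
theorem mem_absPatch_concat_iff (h : IsPatchModel P K L φ) {w : List (PatchGen P K)}
    {s : PatchGen P K} (hs : φ (w ++ [s]) ≠ none) {t : Set (Eu d)} {y : Eu d} (hyt : y ∈ t)
    (hy : dist y (wordVal w) ≤ K * tileRadius P)
    (hy' : dist y (wordVal (w ++ [s])) ≤ K * tileRadius P) :
    t ∈ absPatch φ (w ++ [s]) ↔ t ∈ absPatch φ w := by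
  obtain ⟨m, hm⟩ := Option.ne_none_iff_exists'.1 hs
  rw [mem_absPatch_iff hm, mem_absPatch_iff (h.eq_init hs)]
  rw [wordVal_append, wordVal_singleton] at hy' ⊢
  have key := Set.ext_iff.1 (h.mem_term hm : Match _ _ _) (-wordVal w +ᵥ t)
  have hmeet : ((-wordVal w +ᵥ t) ∩ (patchBall P K 0 ∩ patchBall P K s.val)).Nonempty := by
    refine ⟨-wordVal w +ᵥ y, ⟨y, hyt, rfl⟩, ?_, ?_⟩
    · simpa [patchBall, dist_eq_norm, sub_eq_neg_add] using hy
    · have : -wordVal w + y - s.val = y - (wordVal w + s.val) := by abel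
      simpa [patchBall, dist_eq_norm, this] using hy'
  simp only [meeting, Set.mem_ofPred_eq, hmeet, and_true, Set.mem_vadd_set_iff_neg_vadd_mem,
    vadd_vadd] at key
  rwa [neg_add_rev]

theorem mem_absPatch_append_iff_of_length_le_one (h : IsPatchModel P K L φ)
    {w b : List (PatchGen P K)} (hb : b.length ≤ 1) (hs : φ (w ++ b) ≠ none) {t : Set (Eu d)}
    {y : Eu d} (hyt : y ∈ t) (hy : dist y (wordVal w) ≤ K * tileRadius P)
    (hy' : dist y (wordVal (w ++ b)) ≤ K * tileRadius P) :
    t ∈ absPatch φ (w ++ b) ↔ t ∈ absPatch φ w := by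
  match b, hb with
  | [], _ => simp
  | [s], _ => exact h.mem_absPatch_concat_iff hs hyt hy hy'

theorem dist_wordVal_append_le (h : IsPatchModel P K L φ) (w : List (PatchGen P K))
    {b : List (PatchGen P K)} (hb : b.length ≤ 1) :
    dist (wordVal (w ++ b)) (wordVal w) ≤ 3 * tileRadius P := by
  have := h.radius_pos
  match b, hb with
  | [], _ => simpa using this.le
  | [s], _ => simpa [wordVal_append, wordVal_singleton, PatchGen.val] using s.2.2.1

end IsPatchModel

/-! ### Similar words -/

/-- Two words are interchangeable for `φ` if they have the same valuation and `φ` takes the same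
values on their extensions. -/
def Interchangeable (φ : List (PatchGen P K) → Option (PatchState P K))
    (w w' : List (PatchGen P K)) : Prop :=
  wordVal w = wordVal w' ∧ ∀ y, φ (w ++ y) = φ (w' ++ y)

namespace Interchangeable

variable {φ : List (PatchGen P K) → Option (PatchState P K)} {w w' w'' : List (PatchGen P K)}

theorem refl (w : List (PatchGen P K)) : Interchangeable φ w w := ⟨rfl, fun _ => rfl⟩

theorem symm (h : Interchangeable φ w w') : Interchangeable φ w' w :=
  ⟨h.1.symm, fun y => (h.2 y).symm⟩

theorem trans (h : Interchangeable φ w w') (h' : Interchangeable φ w' w'') :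
    Interchangeable φ w w'' :=
  ⟨h.1.trans h'.1, fun y => (h.2 y).trans (h'.2 y)⟩

theorem append (h : Interchangeable φ w w') (y : List (PatchGen P K)) :
    Interchangeable φ (w ++ y) (w' ++ y) :=
  ⟨by rw [wordVal_append, wordVal_append, h.1], fun z => by simpa using h.2 (y ++ z)⟩

theorem eq (h : Interchangeable φ w w') : φ w = φ w' := by simpa using h.2 []

theorem absPatch_eq (h : Interchangeable φ w w') : absPatch φ w = absPatch φ w' := by
  unfold absPatch
  rw [h.eq, h.1]

end Interchangeable

namespace IsPatchModel

variable {φ : List (PatchGen P K) → Option (PatchState P K)}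

/-- Both a and b start at the state φ(w), so (a, b) is a relation and the model condition equates φ
on extensions where both values are defined. That they are defined simultaneously follows by
induction on the extension, since φ at the next letter is ∅ or not according to the current value.
-/
theorem interchangeable_append (h : IsPatchModel P K L φ) {w a b : List (PatchGen P K)}
    (ha : a ≠ []) (hb : b ≠ []) (hwa : φ (w ++ a) ≠ none) (hwb : φ (w ++ b) ≠ none)
    (hlen : a.length + b.length ≤ 4) (hval : wordVal a = wordVal b) :
    Interchangeable φ (w ++ a) (w ++ b) := by
  refine ⟨by rw [wordVal_append, wordVal_append, hval], fun y => ?_⟩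
  have key : ∀ y, φ (w ++ a ++ y) ≠ none → φ (w ++ b ++ y) ≠ none →
      φ (w ++ a ++ y) = φ (w ++ b ++ y) := by
    intro y hay hby
    refine h.isModel.2 _ _ hay hby (Relation.EqvGen.rel _ _
      ⟨h.consistentWord hay, h.consistentWord hby, a, b, w, y, ?_, rfl, rfl⟩)
    obtain ⟨s, u, rfl⟩ := List.exists_cons_of_ne_nil ha
    obtain ⟨s', u', rfl⟩ := List.exists_cons_of_ne_nil hb
    have hs := h.eq_init_of_cons hwa
    rw [h.eq_init_of_cons hwb] at hs
    exact ⟨hlen.trans h.four_le, ⟨s, u, s', u', rfl, rfl, (Option.some.inj hs).symm⟩, hval⟩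
  induction y using List.reverseRecOn with
  | nil => exact key [] (by simpa using hwa) (by simpa using hwb)
  | append_singleton y s ih =>
    by_cases hs : φ (w ++ a ++ y) = some s.1.1
    · refine key _ ?_ ?_ <;> rw [← List.append_assoc _ y]
      · exact h.concat_ne_none hs
      · exact h.concat_ne_none (ih ▸ hs)
    · rw [← List.append_assoc _ y, ← List.append_assoc _ y, (h.isModel.1.2 _ s).2 hs,
        (h.isModel.1.2 _ s).2 (ih ▸ hs)]

/-- A point of the ball around the valuation of a word is reached, up to `K ρ`, by a tile next to
the central one. -/
theorem exists_direction (h : IsPatchModel P K L φ) {w : List (PatchGen P K)} (hw : φ w ≠ none)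
    {y : Eu d} (hy : dist y (wordVal w) ≤ K * tileRadius P) :
    ∃ t ∈ absPatch φ w, ∃ u, IsPos P t u ∧ u ≠ wordVal w ∧
      dist u (wordVal w) ≤ 3 * tileRadius P ∧ dist y u ≤ K * tileRadius P ∧
      (2 * tileRadius P ≤ dist y (wordVal w) →
        dist y u ≤ dist y (wordVal w) - tileRadius P) := by
  have hρ := h.radius_pos
  have hK := h.six_mul_le
  have : Nonempty (Fin d) := ⟨⟨0, h.one_le_dim⟩⟩
  obtain ⟨e, he, hye⟩ : ∃ e : Eu d, ‖e‖ = 1 ∧ y - wordVal w = dist y (wordVal w) • e := by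
    by_cases hyw : y = wordVal w
    · obtain ⟨e, he⟩ := exists_norm_eq (Eu d) zero_le_one
      exact ⟨e, he, by simp [hyw]⟩
    · have h0 : ‖y - wordVal w‖ ≠ 0 := norm_ne_zero_iff.2 (sub_ne_zero.2 hyw)
      refine ⟨‖y - wordVal w‖⁻¹ • (y - wordVal w), ?_, ?_⟩
      · rw [norm_smul, norm_inv, norm_norm, inv_mul_cancel₀ h0]
      · rw [dist_eq_norm, smul_smul, mul_inv_cancel₀ h0, one_smul]
  -- A tile through a point at distance 2ρ has its position at distance between ρ and 3ρ: it is not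
  -- the central tile, and a generator reaches it. Going 2ρ towards y and losing at most ρ to the
  -- tile gains at least ρ once y is 2ρ away; otherwise the new distance is at most 3ρ.
  set z : Eu d := wordVal w + (2 * tileRadius P) • e with hz
  have hzw : dist z (wordVal w) = 2 * tileRadius P := by
    rw [hz, dist_eq_norm, add_sub_cancel_left, norm_smul, he, Real.norm_of_nonneg (by positivity),
      mul_one]
  have hyz : dist y z = |dist y (wordVal w) - 2 * tileRadius P| := by
    have : y - z = (dist y (wordVal w) - 2 * tileRadius P) • e := by
      rw [sub_smul, ← hye, hz]
      abel
    rw [dist_eq_norm, this, norm_smul, he, mul_one, Real.norm_eq_abs]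
  obtain ⟨t, ht, hzt⟩ := exists_mem_absPatch hw (y := z) (by linarith)
  obtain ⟨u, hu⟩ := exists_isPos_of_mem_absPatch ht
  have hzu := h.dist_le_of_isPos hu hzt
  have hyu := dist_triangle y z u
  have huw := dist_triangle u z (wordVal w)
  rw [dist_comm u z] at huw
  have hd := dist_nonneg (x := y) (y := wordVal w)
  refine ⟨t, ht, u, hu, ?_, by linarith, ?_, fun h2 => ?_⟩
  · rintro rfl
    linarith
  · rcases abs_cases (dist y (wordVal w) - 2 * tileRadius P) with h' | h' <;> linarith
  · rw [abs_of_nonneg (by linarith)] at hyz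
    linarith

theorem absPatch_subset_of_match {w : List (PatchGen P K)}
    {A : Set (Set (Eu d))} (H : ∀ t y, y ∈ t → dist y (wordVal w) ≤ K * tileRadius P →
      (t ∈ absPatch φ w → t ∈ A)) : absPatch φ w ⊆ A := by
  intro t ht
  obtain ⟨y, hyt, hy⟩ := exists_meet_of_mem_absPatch ht
  exact H t y hyt hy ht

/-- Short loops act trivially. -/
theorem interchangeable_append_loop (h : IsPatchModel P K L φ) {w a b : List (PatchGen P K)}
    (ha : a.length ≤ 1) (hb : b.length ≤ 1) (hw : φ (w ++ a ++ b) ≠ none)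
    (hval : wordVal (w ++ a ++ b) = wordVal w) : Interchangeable φ (w ++ a ++ b) w := by
  have hρ := h.radius_pos
  have hK := h.six_mul_le
  have hwa := h.ne_none_of_append hw
  have hw0 := h.ne_none_of_append hwa
  have hda := h.dist_wordVal_append_le w ha
  -- This is where K ≥ 6 is used: y is within 3ρ of both ends of the loop, hence within 6ρ of its
  -- middle vertex, and can be compared through the patch there.
  have hmatch : ∀ t (y : Eu d), y ∈ t → dist y (wordVal w) ≤ 3 * tileRadius P →
      (t ∈ absPatch φ (w ++ a ++ b) ↔ t ∈ absPatch φ w) := by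
    intro t y hyt hy
    have := dist_triangle_right y (wordVal (w ++ a)) (wordVal w)
    rw [h.mem_absPatch_append_iff_of_length_le_one hb hw hyt (by linarith)
      (by rw [hval]; linarith), h.mem_absPatch_append_iff_of_length_le_one ha hwa hyt
      (by linarith) (by linarith)]
  have hcval : wordVal (a ++ b) = 0 := by
    simpa [wordVal_append, add_assoc] using hval
  -- Relations exclude the empty word, so the loop ab cannot be cancelled directly. Instead abs' is
  -- compared with s, which takes total length 3 + 1 = 4.
  have hletter : ∀ s s' : PatchGen P K, φ (w ++ [s]) ≠ none → φ (w ++ a ++ b ++ [s']) ≠ none →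
      s.val = s'.val → Interchangeable φ (w ++ a ++ b ++ [s']) (w ++ [s]) := by
    intro s s' hs hs' hss
    have := h.interchangeable_append (w := w) (a := a ++ b ++ [s']) (b := [s]) (by simp) (by simp)
      (by simpa using hs') hs (by simp; omega)
      (by rw [wordVal_append, hcval, zero_add, wordVal_singleton, wordVal_singleton, hss])
    simpa using this
  -- Beyond 3ρ the patches at the two ends of the loop are compared through a common neighbour whose
  -- ball still contains y. By `hmatch` both patches contain the tile of this neighbour, and by
  -- `hletter` the letters leading to it have the same absolute patch.
  have hiff : ∀ t (y : Eu d), y ∈ t → dist y (wordVal w) ≤ K * tileRadius P →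
      (t ∈ absPatch φ (w ++ a ++ b) ↔ t ∈ absPatch φ w) := by
    intro t y hyt hy
    obtain ⟨t₁, ht₁, u, hu, hne, hle, hyu, -⟩ := h.exists_direction hw0 hy
    obtain ⟨s, hs, hsu⟩ := h.exists_letter ht₁ hu hne hle
    obtain ⟨s', hs', hsu'⟩ := h.exists_letter
      ((hmatch _ _ (h.mem_of_isPos hu) hle).2 ht₁) hu (by rwa [hval]) (by rwa [hval])
    rw [← hsu, ← wordVal_singleton, ← wordVal_append] at hyu
    have hI := hletter s s' hs hs' (add_left_cancel (a := wordVal w) (by rw [hsu, ← hsu', hval]))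
    rw [← h.mem_absPatch_concat_iff hs hyt hy hyu,
      ← h.mem_absPatch_concat_iff hs' hyt (by rwa [hval]) (by rwa [hI.1]), hI.absPatch_eq]
  have heq : φ (w ++ a ++ b) = φ w := by
    obtain ⟨m, hm⟩ := Option.ne_none_iff_exists'.1 hw
    obtain ⟨m', hm'⟩ := Option.ne_none_iff_exists'.1 hw0
    have hA : absPatch φ (w ++ a ++ b) = absPatch φ w :=
      Set.Subset.antisymm
        (absPatch_subset_of_match fun t y hyt hy => (hiff t y hyt (by rwa [← hval])).1)
        (absPatch_subset_of_match fun t y hyt hy => (hiff t y hyt hy).2)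
    rw [hm, hm', Option.some_inj]
    refine Subtype.ext (Set.ext fun t => ?_)
    have := Set.ext_iff.1 hA (wordVal w +ᵥ t)
    rw [mem_absPatch_iff hm, mem_absPatch_iff hm', hval, neg_vadd_vadd] at this
    exact this
  refine ⟨hval, fun y => ?_⟩
  match y with
  | [] => simpa using heq
  | s :: y =>
    have e1 : w ++ a ++ b ++ s :: y = w ++ a ++ b ++ [s] ++ y := by simp
    have e2 : w ++ s :: y = w ++ [s] ++ y := by simp
    rw [e1, e2]
    by_cases hs : φ w = some s.1.1
    · exact (hletter s s (h.concat_ne_none hs) (h.concat_ne_none (heq ▸ hs)) rfl).2 y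
    · rw [h.append_eq_none ((h.isModel.1.2 _ s).2 hs),
        h.append_eq_none ((h.isModel.1.2 _ s).2 (heq ▸ hs))]

end IsPatchModel

/-! ### Adjacent words -/

/-- Two words are adjacent if the first one, possibly extended by a letter, is interchangeable with
the second one. -/
def Adjacent (φ : List (PatchGen P K) → Option (PatchState P K))
    (w w' : List (PatchGen P K)) : Prop :=
  ∃ b : List (PatchGen P K), b.length ≤ 1 ∧ φ (w ++ b) ≠ none ∧ Interchangeable φ (w ++ b) w'

theorem Adjacent.refl {φ : List (PatchGen P K) → Option (PatchState P K)} {w : List (PatchGen P K)}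
    (hw : φ w ≠ none) : Adjacent φ w w :=
  ⟨[], by simp, by simpa using hw, by simpa using .refl w⟩

theorem Adjacent.right_ne_none {φ : List (PatchGen P K) → Option (PatchState P K)}
    {w w' : List (PatchGen P K)} (hww : Adjacent φ w w') : φ w' ≠ none := by
  obtain ⟨b, -, hw, hI⟩ := hww
  rwa [← hI.eq]

namespace IsPatchModel

variable {φ : List (PatchGen P K) → Option (PatchState P K)} {w w' w'' : List (PatchGen P K)}

theorem adjacent_concat {s : PatchGen P K}
    (hs : φ (w ++ [s]) ≠ none) : Adjacent φ w (w ++ [s]) :=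
  ⟨[s], by simp, hs, .refl _⟩

theorem exists_adjacent (h : IsPatchModel P K L φ) {t : Set (Eu d)}
    {u : Eu d} (ht : t ∈ absPatch φ w) (hu : IsPos P t u)
    (hle : dist u (wordVal w) ≤ 3 * tileRadius P) : ∃ w', Adjacent φ w w' ∧ wordVal w' = u := by
  by_cases hne : u = wordVal w
  · exact ⟨w, .refl (ne_none_of_mem_absPatch ht), hne.symm⟩
  · obtain ⟨s, hs, hsu⟩ := h.exists_letter ht hu hne hle
    exact ⟨w ++ [s], adjacent_concat hs, by rw [wordVal_append, wordVal_singleton, hsu]⟩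

theorem dist_le_of_adjacent (h : IsPatchModel P K L φ) (hww : Adjacent φ w w') :
    dist (wordVal w') (wordVal w) ≤ 3 * tileRadius P := by
  obtain ⟨b, hb, -, hI⟩ := hww
  rw [← hI.1]
  exact h.dist_wordVal_append_le w hb

theorem mem_absPatch_iff_of_adjacent (h : IsPatchModel P K L φ) (hww : Adjacent φ w w')
    {t : Set (Eu d)} {y : Eu d} (hyt : y ∈ t)
    (hy : dist y (wordVal w) ≤ K * tileRadius P) (hy' : dist y (wordVal w') ≤ K * tileRadius P) :
    t ∈ absPatch φ w' ↔ t ∈ absPatch φ w := by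
  obtain ⟨b, hb, hw, hI⟩ := hww
  rw [← hI.1] at hy'
  rw [← hI.absPatch_eq, h.mem_absPatch_append_iff_of_length_le_one hb hw hyt hy hy']

/-- The central tile at w is visible from w', so some b' of length at most 1 leads back from w' to
its position. With b leading from w to w', the loop bb' acts trivially at w. -/
theorem adjacent_symm (h : IsPatchModel P K L φ) (hww : Adjacent φ w w') : Adjacent φ w' w := by
  have hρ := h.radius_pos
  have hK := h.six_mul_le
  have hd := h.dist_le_of_adjacent hww
  have hw' := hww.right_ne_none
  have hmem := fun {t} {y} => h.mem_absPatch_iff_of_adjacent hww (t := t) (y := y)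
  obtain ⟨b, hb, hwb, hI⟩ := hww
  obtain ⟨t, ht, hpos⟩ := h.exists_central_tile (h.ne_none_of_append hwb)
  obtain ⟨w'', ⟨b', hb', hw'b', hI'⟩, hw''⟩ := h.exists_adjacent
    ((hmem (h.mem_of_isPos hpos) (by simp; positivity)
      (by rw [dist_comm]; linarith)).2 ht) hpos (by rwa [dist_comm])
  have hI₂ := hI.append b'
  refine ⟨b', hb', hw'b', hI₂.symm.trans (h.interchangeable_append_loop hb hb' ?_ ?_)⟩
  · rwa [hI₂.eq]
  · rw [hI₂.1, hI'.1, hw'']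

/-- The central tile at w'' is visible from w' and then from w. If it is not the tile at w, a letter
s leads straight to it, and the triangle closes by a relation between s and ab of total length at
most 3; otherwise ab is a short loop. -/
theorem adjacent_trans (h : IsPatchModel P K L φ) (h₁ : Adjacent φ w w') (h₂ : Adjacent φ w' w'')
    (hd : dist (wordVal w'') (wordVal w) ≤ 3 * tileRadius P) : Adjacent φ w w'' := by
  have hρ := h.radius_pos
  have hK := h.six_mul_le
  have hd₂ := h.dist_le_of_adjacent h₂
  obtain ⟨t, ht, hpos⟩ := h.exists_central_tile h₂.right_ne_none
  have hmem := h.mem_of_isPos hpos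
  rw [h.mem_absPatch_iff_of_adjacent h₂ hmem (by linarith) (by simp; positivity),
    h.mem_absPatch_iff_of_adjacent h₁ hmem (by linarith) (by linarith)] at ht
  obtain ⟨a, ha, hwa, hIa⟩ := h₁
  obtain ⟨b, hb, hwb, hIb⟩ := h₂
  have hI := (hIa.append b).trans hIb
  have hwab : φ (w ++ a ++ b) ≠ none := by rwa [(hIa.append b).eq]
  by_cases hne : wordVal w'' = wordVal w
  · have := h.interchangeable_append_loop ha hb hwab (by rw [hI.1, hne])
    exact ⟨[], by simp, by simpa using ne_none_of_mem_absPatch ht,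
      by simpa using this.symm.trans hI⟩
  · obtain ⟨s, hs, hsu⟩ := h.exists_letter ht hpos hne hd
    refine ⟨[s], by simp, hs, .trans ?_ hI⟩
    rw [List.append_assoc]
    have hval : wordVal w + wordVal (a ++ b) = wordVal w'' := by
      rw [← hI.1, List.append_assoc, wordVal_append w]
    refine h.interchangeable_append (by simp) ?_ hs (by simpa using hwab) (by simp; omega) ?_
    · intro h0
      rw [h0, wordVal_nil, add_zero] at hval
      exact hne hval.symm
    · rw [wordVal_singleton]
      exact add_left_cancel (hsu.trans hval.symm)

end IsPatchModel

/-! ### The values of `Psi` -/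

/-- The patch of a punctured tiling around the origin. -/
def patchAt (K : ℕ) {T : Set (Set (Eu d))} (hT : T ∈ puncturedTilings P) : PatchState P K :=
  ⟨meeting T (patchBall P K 0), T, hT, rfl⟩

theorem patchAt_congr {T T' : Set (Set (Eu d))} (h : T = T') (hT : T ∈ puncturedTilings P)
    (hT' : T' ∈ puncturedTilings P) : patchAt K hT = patchAt K hT' := by
  subst h
  rfl

theorem Psi_nil' (T : PuncturedTilingSpace P) : Psi P K T [] = some (patchAt K T.2) :=
  Psi_nil P K T

theorem Psi_concat_of_eq {T : PuncturedTilingSpace P} {w : List (PatchGen P K)} {s : PatchGen P K}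
    (hw : Psi P K T w = some s.1.1) (hT : -wordVal (w ++ [s]) +ᵥ T.1 ∈ puncturedTilings P) :
    Psi P K T (w ++ [s]) = some (patchAt K hT) :=
  (Psi_concat P K T w s).trans (dif_pos ⟨hw, hT⟩)

theorem Psi_concat_of_ne {T : PuncturedTilingSpace P} {w : List (PatchGen P K)} {s : PatchGen P K}
    (hw : Psi P K T w ≠ some s.1.1) : Psi P K T (w ++ [s]) = none :=
  (Psi_concat P K T w s).trans (dif_neg fun h => hw h.1)

/-- On its support, Ψ(T) depends on a word through the valuation alone. -/
theorem Psi_eq_some {T : PuncturedTilingSpace P} {w : List (PatchGen P K)}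
    (hw : Psi P K T w ≠ none) :
    ∃ hT : -wordVal w +ᵥ T.1 ∈ puncturedTilings P, Psi P K T w = some (patchAt K hT) := by
  induction w using List.reverseRecOn with
  | nil =>
    have hT : -wordVal ([] : List (PatchGen P K)) +ᵥ T.1 ∈ puncturedTilings P := by
      simpa [wordVal_nil] using T.2
    exact ⟨hT, (Psi_nil' T).trans (congrArg some (patchAt_congr (by simp [wordVal_nil]) _ _))⟩
  | append_singleton w s _ =>
    by_cases h : Psi P K T w = some s.1.1 ∧ -wordVal (w ++ [s]) +ᵥ T.1 ∈ puncturedTilings P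
    · exact ⟨h.2, Psi_concat_of_eq h.1 h.2⟩
    · exact absurd ((Psi_concat P K T w s).trans (dif_neg h)) hw

/-! ### Words along rays -/

/-- `Follows φ e n w`: the word `w` is the end of a chain of `n` adjacent words which starts with
the empty word and follows the multiples of the vector `e`. -/
def Follows (φ : List (PatchGen P K) → Option (PatchState P K)) (e : Eu d) :
    ℕ → List (PatchGen P K) → Prop
  | 0, w => w = []
  | n + 1, w => dist (wordVal w) (((n + 1 : ℕ) : ℝ) • e) ≤ tileRadius P ∧
      ∃ w', Follows φ e n w' ∧ Adjacent φ w' w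

namespace IsPatchModel

variable {φ : List (PatchGen P K) → Option (PatchState P K)} {w w' : List (PatchGen P K)}

theorem dist_le_of_follows (h : IsPatchModel P K L φ) {e : Eu d} {n : ℕ}
    (hw : Follows φ e n w) : dist (wordVal w) ((n : ℝ) • e) ≤ tileRadius P := by
  cases n with
  | zero =>
    obtain rfl : w = [] := hw
    simpa [wordVal_nil] using h.radius_pos.le
  | succ n => exact hw.1

theorem ne_none_of_follows (h : IsPatchModel P K L φ) {e : Eu d} {n : ℕ}
    (hw : Follows φ e n w) : φ w ≠ none := by
  cases n with
  | zero =>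
    obtain rfl : w = [] := hw
    exact h.nil_ne_none
  | succ n =>
    obtain ⟨-, w', -, hww⟩ := hw
    exact hww.right_ne_none

theorem dist_succ_smul (e : Eu d) (n : ℕ) : dist (((n + 1 : ℕ) : ℝ) • e) ((n : ℝ) • e) = ‖e‖ := by
  rw [dist_eq_norm, ← sub_smul]
  simp

theorem exists_follows (h : IsPatchModel P K L φ) {e : Eu d} (he : ‖e‖ ≤ tileRadius P / 2)
    (n : ℕ) : ∃ w, Follows φ e n w := by
  have hρ := h.radius_pos
  have hK := h.six_mul_le
  induction n with
  | zero => exact ⟨[], rfl⟩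
  | succ n ih =>
    obtain ⟨w, hw⟩ := ih
    have h1 := h.dist_le_of_follows hw
    have h2 := dist_succ_smul e n
    have h3 := dist_triangle_right (((n + 1 : ℕ) : ℝ) • e) (wordVal w) ((n : ℝ) • e)
    obtain ⟨t, ht, hyt⟩ := exists_mem_absPatch (h.ne_none_of_follows hw)
      (y := ((n + 1 : ℕ) : ℝ) • e) (by linarith)
    obtain ⟨u, hu⟩ := exists_isPos_of_mem_absPatch ht
    have h4 := h.dist_le_of_isPos hu hyt
    have h5 := dist_triangle_left u (wordVal w) (((n + 1 : ℕ) : ℝ) • e)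
    -- The new position is within ρ of the next point of the ray, which is within ρ/2 + ρ of the old
    -- position: 5ρ/2 in all.
    obtain ⟨w', hww, rfl⟩ := h.exists_adjacent ht hu (by linarith)
    exact ⟨w', by rwa [dist_comm], w, hw, hww⟩

/-- Words along nearby rays are adjacent. -/
theorem adjacent_of_follows (h : IsPatchModel P K L φ) {e e' : Eu d}
    (he : ‖e‖ ≤ tileRadius P / 2) {n : ℕ}
    (hn : n * ‖e - e'‖ ≤ tileRadius P / 2) {w w' : List (PatchGen P K)}
    (hw : Follows φ e n w) (hw' : Follows φ e' n w') : Adjacent φ w w' := by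
  have hρ := h.radius_pos
  induction n generalizing w w' with
  | zero =>
    obtain rfl : w = [] := hw
    obtain rfl : w' = [] := hw'
    exact .refl h.nil_ne_none
  | succ n ih =>
    have hn' : n * ‖e - e'‖ ≤ tileRadius P / 2 :=
      le_trans (mul_le_mul_of_nonneg_right (by simp) (norm_nonneg _)) hn
    have hd : dist (((n + 1 : ℕ) : ℝ) • e) (((n + 1 : ℕ) : ℝ) • e') ≤ tileRadius P / 2 := by
      rw [dist_eq_norm, ← smul_sub, norm_smul, Real.norm_of_nonneg (by positivity)]
      exact hn
    have hd' : dist ((n : ℝ) • e) ((n : ℝ) • e') ≤ tileRadius P / 2 := by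
      rw [dist_eq_norm, ← smul_sub, norm_smul, Real.norm_of_nonneg (by positivity)]
      exact hn'
    obtain ⟨hwd, v, hv, hvw⟩ := hw
    obtain ⟨hwd', v', hv', hvw'⟩ := hw'
    have hvd := h.dist_le_of_follows hv
    have hvd' := h.dist_le_of_follows hv'
    have hs := dist_succ_smul e n
    -- One rung of the ladder, w – v – v' – w', closed by two triangles. The diagonal from v' to w
    -- has length at most ρ + ρ/2 + ρ/2 + ρ = 3ρ, which explains the bounds ρ/2 on the step and on
    -- the gap between the rays.
    refine h.adjacent_trans (h.adjacent_trans (h.adjacent_symm hvw) (ih hn' hv hv') ?_) hvw' ?_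
    · have t1 := dist_triangle4 (wordVal v') ((n : ℝ) • e') ((n : ℝ) • e)
        (((n + 1 : ℕ) : ℝ) • e)
      have t2 := dist_triangle_right (wordVal v') (wordVal w) (((n + 1 : ℕ) : ℝ) • e)
      rw [dist_comm ((n : ℝ) • e'), dist_comm ((n : ℝ) • e) (((n + 1 : ℕ) : ℝ) • e)] at t1
      linarith
    · have t1 := dist_triangle4 (wordVal w') (((n + 1 : ℕ) : ℝ) • e') (((n + 1 : ℕ) : ℝ) • e)
        (wordVal w)
      rw [dist_comm (((n + 1 : ℕ) : ℝ) • e') (((n + 1 : ℕ) : ℝ) • e),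
        dist_comm (((n + 1 : ℕ) : ℝ) • e) (wordVal w)] at t1
      linarith

/-- All words which arrive near `y` in `n` steps along the ray from the origin are adjacent
to `w`. -/
def AdjacentToRay (φ : List (PatchGen P K) → Option (PatchState P K)) (n : ℕ) (y : Eu d)
    (w : List (PatchGen P K)) : Prop :=
  ‖y‖ ≤ n * (tileRadius P / 2) ∧ ∀ g, Follows φ ((n : ℝ)⁻¹ • y) n g → Adjacent φ w g

theorem norm_inv_smul_le {n : ℕ} (hn : 0 < n) {y : Eu d} {r : ℝ} (hy : ‖y‖ ≤ n * r) :
    ‖(n : ℝ)⁻¹ • y‖ ≤ r := by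
  have hn' : (0 : ℝ) < n := by exact_mod_cast hn
  rwa [norm_smul, norm_inv, Real.norm_of_nonneg hn'.le, inv_mul_le_iff₀ hn']

theorem dist_le_of_follows_inv_smul (h : IsPatchModel P K L φ) {n : ℕ} (hn : 0 < n) {y : Eu d}
    {g : List (PatchGen P K)} (hg : Follows φ ((n : ℝ)⁻¹ • y) n g) :
    dist (wordVal g) y ≤ tileRadius P := by
  have hn' : (n : ℝ) ≠ 0 := by exact_mod_cast hn.ne'
  simpa [smul_smul, hn'] using h.dist_le_of_follows hg

/-- Chains along the two rays end at adjacent words. Chains to y' end within ρ of y', hence within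
3ρ of w, so transitivity applies. -/
theorem adjacentToRay_of_dist_le (h : IsPatchModel P K L φ) {n : ℕ} (hn : 0 < n) {y y' : Eu d}
    (hy : AdjacentToRay φ n y w) (hy' : ‖y'‖ ≤ n * (tileRadius P / 2))
    (hyy : dist y y' ≤ tileRadius P / 2) (hw : dist y' (wordVal w) ≤ 2 * tileRadius P) :
    AdjacentToRay φ n y' w := by
  refine ⟨hy', fun g' hg' => ?_⟩
  have he := norm_inv_smul_le hn hy.1
  obtain ⟨g, hg⟩ := h.exists_follows he n
  refine h.adjacent_trans (hy.2 g hg)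
    (h.adjacent_of_follows he ?_ hg hg') ?_
  · rw [← smul_sub, norm_smul, norm_inv, Real.norm_of_nonneg (by positivity), ← dist_eq_norm,
      mul_inv_cancel_left₀ (by exact_mod_cast hn.ne')]
    exact hyy
  · have := h.dist_le_of_follows_inv_smul hn hg'
    have := dist_triangle (wordVal g') y' (wordVal w)
    linarith

theorem adjacentToRay_of_dist_le' (h : IsPatchModel P K L φ) {n : ℕ} (hn : 0 < n) {y y' : Eu d}
    (hy : AdjacentToRay φ n y w) (hy' : ‖y'‖ ≤ n * (tileRadius P / 2))
    (hyy : dist y y' ≤ 3 / 2 * tileRadius P) (hwy : dist y (wordVal w) ≤ 2 * tileRadius P)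
    (hwy' : dist y' (wordVal w) ≤ 2 * tileRadius P) : AdjacentToRay φ n y' w := by
  have hnorm : ∀ a ∈ Set.Icc (0 : ℝ) 1,
      ‖AffineMap.lineMap y y' a‖ ≤ n * (tileRadius P / 2) := by
    intro a ha
    have := (convex_closedBall (0 : Eu d) (n * (tileRadius P / 2))).lineMap_mem
      (mem_closedBall_zero_iff.2 hy.1) (mem_closedBall_zero_iff.2 hy') ha
    simpa using this
  have hdist : ∀ a ∈ Set.Icc (0 : ℝ) 1,
      dist (AffineMap.lineMap y y' a) (wordVal w) ≤ 2 * tileRadius P := by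
    intro a ha
    exact (convex_closedBall (wordVal w) (2 * tileRadius P)).lineMap_mem hwy hwy' ha
  have hstep : ∀ a b : ℝ, |a - b| ≤ 1 / 3 →
      dist (AffineMap.lineMap y y' a : Eu d) (AffineMap.lineMap y y' b) ≤ tileRadius P / 2 := by
    intro a b hab
    rw [dist_lineMap_lineMap, Real.dist_eq]
    have := mul_le_mul hab hyy dist_nonneg (by norm_num)
    linarith
  -- The segment is cut into three pieces of length at most ρ/2; convexity of balls keeps the
  -- division points within reach of w and of n steps.
  have h0 : AdjacentToRay φ n (AffineMap.lineMap y y' (0 : ℝ)) w := by simpa using hy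
  have h1 := h.adjacentToRay_of_dist_le hn h0 (hnorm (1 / 3) (by norm_num))
    (hstep 0 (1 / 3) (by norm_num)) (hdist _ (by norm_num))
  have h2 := h.adjacentToRay_of_dist_le hn h1 (hnorm (2 / 3) (by norm_num))
    (hstep (1 / 3) (2 / 3) (by norm_num)) (hdist _ (by norm_num))
  have h3 := h.adjacentToRay_of_dist_le hn h2 (hnorm 1 (by norm_num))
    (hstep (2 / 3) 1 (by norm_num)) (hdist _ (by norm_num))
  simpa using h3

theorem dist_midpoint_le {x y : Eu d} {r : ℝ} (hxy : dist x y ≤ 3 * r) :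
    dist (midpoint ℝ x y) x ≤ 3 / 2 * r ∧ dist (midpoint ℝ x y) y ≤ 3 / 2 * r := by
  rw [dist_midpoint_left, dist_midpoint_right, Real.norm_of_nonneg zero_le_two]
  constructor <;> linarith

/-- The ray is swept along the path of w, letter by letter. The claim is made for all large n
because longer words may need more steps, and two words must later be compared with the same n. -/
theorem exists_adjacentToRay (h : IsPatchModel P K L φ) (hw : φ w ≠ none) :
    ∃ N > 0, ∀ n ≥ N, AdjacentToRay φ n (wordVal w) w := by
  have hρ := h.radius_pos
  induction w using List.reverseRecOn with
  | nil =>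
    refine ⟨1, one_pos, fun n hn => ⟨by rw [wordVal_nil, norm_zero]; positivity, ?_⟩⟩
    rw [wordVal_nil, smul_zero]
    clear hn
    induction n with
    | zero =>
      rintro g rfl
      exact .refl hw
    | succ n ih =>
      rintro g ⟨hg, g', hg', hadj⟩
      refine h.adjacent_trans (ih g' hg') hadj ?_
      rw [smul_zero] at hg
      rw [wordVal_nil]
      linarith
  | append_singleton w s ih =>
    obtain ⟨N, hN, hwN⟩ := ih (h.ne_none_of_append hw)
    obtain ⟨N', hN'⟩ := exists_nat_ge (‖wordVal (w ++ [s])‖ / (tileRadius P / 2))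
    rw [div_le_iff₀ (by positivity)] at hN'
    refine ⟨max N N', lt_max_of_lt_left hN, fun n hn => ?_⟩
    have hnN := (le_max_left _ _).trans hn
    have hn0 : 0 < n := hN.trans_le hnN
    have hd := h.dist_wordVal_append_le w (b := [s]) (by simp)
    obtain ⟨hm₁, hm₂⟩ := dist_midpoint_le (r := tileRadius P) (x := wordVal w)
      (y := wordVal (w ++ [s])) (by rwa [dist_comm])
    set z := midpoint ℝ (wordVal w) (wordVal (w ++ [s]))
    have hnorm : ‖wordVal (w ++ [s])‖ ≤ n * (tileRadius P / 2) := hN'.trans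
      (mul_le_mul_of_nonneg_right (by exact_mod_cast (le_max_right _ _).trans hn) (by positivity))
    have hz : ‖z‖ ≤ n * (tileRadius P / 2) := by
      have := (convex_closedBall (0 : Eu d) (n * (tileRadius P / 2))).midpoint_mem
        (mem_closedBall_zero_iff.2 (hwN n hnN).1) (mem_closedBall_zero_iff.2 hnorm)
      simpa using this
    have hwz : AdjacentToRay φ n z w := h.adjacentToRay_of_dist_le' hn0 (hwN n hnN) hz
      (by rwa [dist_comm]) (by simp; positivity) (by linarith)
    -- Halfway along the letter, w is exchanged for ws: the midpoint is within 3ρ/2 of both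
    -- valuations, so chains to it end within 5ρ/2 of either.
    have hsz : AdjacentToRay φ n z (w ++ [s]) := by
      refine ⟨hz, fun g hg => ?_⟩
      refine h.adjacent_trans (h.adjacent_symm (adjacent_concat hw)) (hwz.2 g hg) ?_
      have := h.dist_le_of_follows_inv_smul hn0 hg
      have := dist_triangle (wordVal g) z (wordVal (w ++ [s]))
      linarith
    exact h.adjacentToRay_of_dist_le' hn0 hsz hnorm hm₂ (by linarith) (by simp; positivity)

/-- Any two words of the support with nearby valuations are adjacent. -/
theorem adjacent_of_dist_le (h : IsPatchModel P K L φ) (hw : φ w ≠ none) (hw' : φ w' ≠ none)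
    (hd : dist (wordVal w') (wordVal w) ≤ 3 * tileRadius P) : Adjacent φ w w' := by
  have hρ := h.radius_pos
  obtain ⟨N, hN, hwN⟩ := h.exists_adjacentToRay hw
  obtain ⟨N', -, hwN'⟩ := h.exists_adjacentToRay hw'
  have h1 := hwN (max N N') (le_max_left _ _)
  have h2 := hwN' (max N N') (le_max_right _ _)
  have hn0 : 0 < max N N' := lt_max_of_lt_left hN
  generalize max N N' = n at *
  obtain ⟨hm₁, hm₂⟩ := dist_midpoint_le (r := tileRadius P) (x := wordVal w)
    (y := wordVal w') (by rwa [dist_comm])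
  have hz : ‖midpoint ℝ (wordVal w) (wordVal w')‖ ≤ n * (tileRadius P / 2) := by
    have := (convex_closedBall (0 : Eu d) (n * (tileRadius P / 2))).midpoint_mem
      (mem_closedBall_zero_iff.2 h1.1) (mem_closedBall_zero_iff.2 h2.1)
    simpa using this
  have hwz := h.adjacentToRay_of_dist_le' hn0 h1 hz
    (by rwa [dist_comm]) (by simp; positivity) (by linarith)
  have hwz' := h.adjacentToRay_of_dist_le' hn0 h2 hz
    (by rwa [dist_comm]) (by simp; positivity) (by linarith)
  obtain ⟨g, hg⟩ := h.exists_follows (norm_inv_smul_le hn0 hz) n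
  exact h.adjacent_trans (hwz.2 g hg) (h.adjacent_symm (hwz'.2 g hg)) hd

theorem exists_wordVal_near (h : IsPatchModel P K L φ) (y : Eu d) :
    ∃ w, φ w ≠ none ∧ dist (wordVal w) y ≤ tileRadius P := by
  have hρ := h.radius_pos
  obtain ⟨n, hn⟩ := exists_nat_ge (‖y‖ / (tileRadius P / 2))
  rw [div_le_iff₀ (by positivity)] at hn
  have hn' : ‖y‖ ≤ (n + 1 : ℕ) * (tileRadius P / 2) :=
    hn.trans (mul_le_mul_of_nonneg_right (by simp) (by positivity))
  obtain ⟨w, hw⟩ := h.exists_follows (norm_inv_smul_le n.succ_pos hn') (n + 1)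
  exact ⟨w, h.ne_none_of_follows hw, h.dist_le_of_follows_inv_smul n.succ_pos hw⟩

/-! ### The tiling of a model -/

/-- Each step towards y gains at least ρ and keeps y in the balls of both words, so adjacent patches
contain the same tiles through y. The walk stops within 2ρ, from where the position of any tile
containing y is within 3ρ. -/
theorem exists_walk (h : IsPatchModel P K L φ) (hw : φ w ≠ none) {y : Eu d}
    (hy : dist y (wordVal w) ≤ K * tileRadius P) :
    ∃ w', φ w' ≠ none ∧ dist y (wordVal w') ≤ 2 * tileRadius P ∧
      ∀ t : Set (Eu d), y ∈ t → (t ∈ absPatch φ w' ↔ t ∈ absPatch φ w) := by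
  have hρ := h.radius_pos
  obtain ⟨n, hn⟩ := exists_nat_ge (dist y (wordVal w) / tileRadius P)
  rw [div_le_iff₀ hρ] at hn
  induction n generalizing w with
  | zero =>
    rw [Nat.cast_zero, zero_mul] at hn
    exact ⟨w, hw, by linarith, fun t _ => Iff.rfl⟩
  | succ n ih =>
    by_cases h2 : 2 * tileRadius P ≤ dist y (wordVal w)
    · obtain ⟨t, ht, u, hu, -, hle, hyu, hyu'⟩ := h.exists_direction hw hy
      obtain ⟨v, hv, rfl⟩ := h.exists_adjacent ht hu hle
      have hlt := hyu' h2
      push_cast at hn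
      obtain ⟨w', hw', hyw', hiff⟩ := ih hv.right_ne_none hyu (by linarith)
      exact ⟨w', hw', hyw', fun t hyt =>
        (hiff t hyt).trans (h.mem_absPatch_iff_of_adjacent hv hyt hy hyu)⟩
    · exact ⟨w, hw, (not_le.1 h2).le, fun t _ => Iff.rfl⟩

/-- A tile of some absolute patch belongs to all absolute patches whose balls it meets. -/
theorem mem_absPatch_of_mem (h : IsPatchModel P K L φ) {t : Set (Eu d)}
    (ht : t ∈ absPatch φ w') (hw : φ w ≠ none) {y : Eu d} (hyt : y ∈ t)
    (hy : dist y (wordVal w) ≤ K * tileRadius P) : t ∈ absPatch φ w := by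
  have hρ := h.radius_pos
  have hK := h.six_mul_le
  obtain ⟨u, hu⟩ := exists_isPos_of_mem_absPatch ht
  have hut := h.mem_of_isPos hu
  have near : ∀ {v : List (PatchGen P K)} {x : Eu d}, x ∈ t → dist x (wordVal v) ≤
      2 * tileRadius P → dist u (wordVal v) ≤ 3 * tileRadius P := by
    intro v x hx hxv
    have := dist_triangle_left u (wordVal v) x
    have := h.dist_le_of_isPos hu hx
    linarith
  -- Walk from w' to a point of t and on to the position of t; walk from w to y. The two resulting
  -- words are within 3ρ of each other, hence adjacent, whatever their paths.
  obtain ⟨x, hxt, hx⟩ := exists_meet_of_mem_absPatch ht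
  obtain ⟨v', -, hxv', hv'⟩ := h.exists_walk (ne_none_of_mem_absPatch ht) hx
  obtain ⟨v'', hv'', rfl⟩ := h.exists_adjacent ((hv' t hxt).2 ht) hu (near hxt hxv')
  have ht'' : t ∈ absPatch φ v'' := (h.mem_absPatch_iff_of_adjacent hv'' hut
    (by linarith [near hxt hxv']) (by simp; positivity)).2 ((hv' t hxt).2 ht)
  obtain ⟨v, hv, hyv, hiff⟩ := h.exists_walk hw hy
  rw [← hiff t hyt]
  exact (h.mem_absPatch_iff_of_adjacent
    (h.adjacent_of_dist_le hv hv''.right_ne_none (near hyt hyv)) hut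
    (by linarith [near hyt hyv]) (by simp; positivity)).1 ht''

end IsPatchModel

/-- The tiling of a model: the union of all absolute patches. -/
def modelTiling (φ : List (PatchGen P K) → Option (PatchState P K)) : Set (Set (Eu d)) :=
  {t | ∃ w, t ∈ absPatch φ w}

namespace IsPatchModel

variable {φ : List (PatchGen P K) → Option (PatchState P K)} {w w' : List (PatchGen P K)}

theorem meeting_modelTiling (h : IsPatchModel P K L φ) (hw : φ w ≠ none) :
    meeting (modelTiling φ) (patchBall P K (wordVal w)) = absPatch φ w := by
  ext t
  constructor
  · rintro ⟨⟨w', ht⟩, y, hyt, hy⟩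
    exact h.mem_absPatch_of_mem ht hw hyt hy
  · intro ht
    obtain ⟨y, hyt, hy⟩ := exists_meet_of_mem_absPatch ht
    exact ⟨⟨w, ht⟩, y, hyt, hy⟩

theorem modelTiling_mem_tilings (h : IsPatchModel P K L φ) : modelTiling φ ∈ tilings P := by
  have hρ := h.radius_pos
  have hK := h.six_mul_le
  refine ⟨⟨⟨?_, ?_⟩, Set.eq_univ_of_forall fun y => ?_⟩, ?_⟩
  · rintro t ⟨w, ht⟩
    exact (isPartialTiling_absPatch (ne_none_of_mem_absPatch ht)).1 t ht
  · rintro t ⟨w, ht⟩ t' ⟨w', ht'⟩ hne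
    -- Two overlapping tiles lie together in a single absolute patch, that of a word ending near a
    -- common interior point.
    refine Set.disjoint_left.2 fun y hy hy' => ?_
    obtain ⟨v, hv, hvy⟩ := h.exists_wordVal_near y
    have hyv : dist y (wordVal v) ≤ K * tileRadius P := by
      rw [dist_comm]
      linarith
    exact Set.disjoint_left.1 ((isPartialTiling_absPatch hv).2
      (h.mem_absPatch_of_mem ht hv (interior_subset hy) hyv)
      (h.mem_absPatch_of_mem ht' hv (interior_subset hy') hyv) hne) hy hy'
  · obtain ⟨v, hv, hvy⟩ := h.exists_wordVal_near y
    obtain ⟨t, ht, hyt⟩ := exists_mem_absPatch hv (y := y) (by rw [dist_comm]; linarith)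
    exact ⟨t, ⟨v, ht⟩, hyt⟩
  · rintro t ⟨w, ht⟩
    exact exists_isPos_of_mem_absPatch ht

theorem vadd_modelTiling_mem (h : IsPatchModel P K L φ) (hw : φ w ≠ none) :
    -wordVal w +ᵥ modelTiling φ ∈ puncturedTilings P := by
  obtain ⟨t, ht, hpos⟩ := h.exists_central_tile hw
  exact vadd_mem_puncturedTilings h.modelTiling_mem_tilings ⟨w, ht⟩ hpos

theorem modelTiling_mem (h : IsPatchModel P K L φ) : modelTiling φ ∈ puncturedTilings P := by
  simpa [wordVal_nil] using h.vadd_modelTiling_mem h.nil_ne_none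

theorem eq_some_patchAt (h : IsPatchModel P K L φ) (hw : φ w ≠ none) :
    φ w = some (patchAt K (h.vadd_modelTiling_mem hw)) := by
  obtain ⟨m, hm⟩ := Option.ne_none_iff_exists'.1 hw
  refine hm.trans (congrArg some (Subtype.ext (Set.ext fun t => ?_)))
  have hb : -wordVal w +ᵥ patchBall P K (wordVal w) = patchBall P K (0 : Eu d) := by
    simp [patchBall]
  have := mem_absPatch_iff hm (t := wordVal w +ᵥ t)
  rw [neg_vadd_vadd] at this
  change _ ↔ t ∈ meeting _ _
  rw [← this, ← h.meeting_modelTiling hw, ← hb, ← vadd_meeting,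
    Set.mem_vadd_set_iff_neg_vadd_mem, neg_neg]

/-- The union of all absolute patches, as a punctured tiling. -/
def tiling (h : IsPatchModel P K L φ) : PuncturedTilingSpace P := ⟨modelTiling φ, h.modelTiling_mem⟩

/-- The value at w decides whether ws is in the support, by the same rule for both maps; on the
support both values are the patch of the translated tiling. -/
theorem Psi_tiling (h : IsPatchModel P K L φ) : Psi P K h.tiling = φ := by
  funext w
  induction w using List.reverseRecOn with
  | nil =>
    rw [Psi_nil', h.eq_some_patchAt h.nil_ne_none]
    exact congrArg some (patchAt_congr (by simp [wordVal_nil]; rfl) _ _)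
  | append_singleton w s ih =>
    by_cases hs : φ w = some s.1.1
    · have hws := h.concat_ne_none hs
      rw [Psi_concat_of_eq (ih.trans hs) (h.vadd_modelTiling_mem hws), h.eq_some_patchAt hws]
      rfl
    · rw [Psi_concat_of_ne (ih.trans_ne hs), (h.isModel.1.2 w s).2 hs]

end IsPatchModel

/-! ### `Psi` takes its values in the space of models -/

/-- The valuation of s is the position of a tile of the current patch, so translating by it gives a
punctured tiling again: the second condition in the recursion for Ψ is automatic. -/
theorem exists_mem_term_Psi_concat {T : PuncturedTilingSpace P} {w : List (PatchGen P K)}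
    {s : PatchGen P K} (hw : Psi P K T w = some s.1.1) :
    ∃ m ∈ patchTerm P K s, Psi P K T (w ++ [s]) = some m := by
  obtain ⟨hT, he⟩ := Psi_eq_some (T := T) (w := w) (by simp [hw])
  have hm : s.1.1 = patchAt K hT := Option.some.inj (hw.symm.trans he)
  obtain ⟨t, ht, hpos⟩ := s.2.2.2
  rw [hm] at ht
  have hval : wordVal (w ++ [s]) = wordVal w + s.val := by
    rw [wordVal_append, wordVal_singleton]
  have hT' := vadd_mem_puncturedTilings hT.1 ht.1 hpos
  have hTs : -wordVal (w ++ [s]) +ᵥ T.1 ∈ puncturedTilings P := by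
    rw [hval, neg_add_rev, ← vadd_vadd]
    exact hT'
  refine ⟨_, ?_, Psi_concat_of_eq hw hTs⟩
  have hb : s.val +ᵥ patchBall P K (0 : Eu d) = patchBall P K s.val := by
    simp [patchBall]
  change meeting (s.val +ᵥ meeting (-wordVal (w ++ [s]) +ᵥ T.1) (patchBall P K 0)) _ =
    meeting s.1.1.1 _
  rw [hm]
  change _ = meeting (meeting (-wordVal w +ᵥ T.1) (patchBall P K 0)) _
  rw [vadd_meeting, hb, meeting_meeting Set.inter_subset_right,
    meeting_meeting Set.inter_subset_left, hval, neg_add_rev, vadd_vadd, add_neg_cancel_left]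

theorem wordVal_eq_of_equivalent {u v : List (PatchGen P K)}
    (h : (patchBlueprint P K L).Equivalent u v) : wordVal u = wordVal v := by
  induction h with
  | rel u v h =>
    obtain ⟨-, -, w, w', x, y, ⟨-, -, hval⟩, rfl, rfl⟩ := h
    have hval' : wordVal w = wordVal w' := hval
    rw [wordVal_append, wordVal_append, wordVal_append, wordVal_append, hval']
  | refl => rfl
  | symm _ _ _ ih => exact ih.symm
  | trans _ _ _ _ _ ih ih' => exact ih.trans ih'

theorem isModel_Psi (L : ℕ) (T : PuncturedTilingSpace P) :
    (patchBlueprint P K L).IsModel (Psi P K T) := by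
  refine ⟨⟨⟨_, Psi_nil' T⟩, fun w s => ⟨exists_mem_term_Psi_concat, Psi_concat_of_ne⟩⟩, ?_⟩
  intro u v hu hv huv
  obtain ⟨hTu, hu⟩ := Psi_eq_some hu
  obtain ⟨hTv, hv⟩ := Psi_eq_some hv
  rw [hu, hv]
  exact congrArg some (patchAt_congr (by rw [wordVal_eq_of_equivalent huv]) _ _)

/-- The map `Psi`, with values in the space of models. -/
noncomputable def modelOfTiling (K L : ℕ) (T : PuncturedTilingSpace P) :
    (patchBlueprint P K L).ModelSpace :=
  ⟨Psi P K T, isModel_Psi L T⟩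

/-! ### `Psi` is a homeomorphism -/

theorem match_iff {T₁ T₂ : Set (Set (Eu d))} {F : Set (Eu d)} :
    Match T₁ T₂ F ↔ ∀ t, ∀ y ∈ t, y ∈ F → (t ∈ T₁ ↔ t ∈ T₂) := by
  constructor
  · intro h t y hyt hyF
    have := Set.ext_iff.1 h t
    have hne : (t ∩ F).Nonempty := ⟨y, hyt, hyF⟩
    simpa [meeting, hne] using this
  · rintro h
    ext t
    constructor
    · rintro ⟨ht, y, hyt, hyF⟩
      exact ⟨(h t y hyt hyF).1 ht, y, hyt, hyF⟩
    · rintro ⟨ht, y, hyt, hyF⟩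
      exact ⟨(h t y hyt hyF).2 ht, y, hyt, hyF⟩

theorem match_vadd_iff {T₁ T₂ : Set (Set (Eu d))} {F : Set (Eu d)} (v : Eu d) :
    Match (v +ᵥ T₁) (v +ᵥ T₂) (v +ᵥ F) ↔ Match T₁ T₂ F := by
  unfold Match
  rw [← vadd_meeting, ← vadd_meeting]
  exact (AddAction.injective v).eq_iff

theorem match_neg_vadd_iff {T₁ T₂ : Set (Set (Eu d))} (v : Eu d) :
    Match (-v +ᵥ T₁) (-v +ᵥ T₂) (patchBall P K 0) ↔ Match T₁ T₂ (patchBall P K v) := by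
  rw [← match_vadd_iff v, vadd_neg_vadd, vadd_neg_vadd]
  simp [patchBall]

theorem match_of_Psi_eq {T₁ T₂ : PuncturedTilingSpace P} {w : List (PatchGen P K)}
    (hw : Psi P K T₁ w ≠ none) (h : Psi P K T₁ w = Psi P K T₂ w) :
    Match T₁.1 T₂.1 (patchBall P K (wordVal w)) := by
  obtain ⟨h₁, e₁⟩ := Psi_eq_some hw
  obtain ⟨h₂, e₂⟩ := Psi_eq_some (h ▸ hw)
  rw [e₁, e₂] at h
  exact (match_neg_vadd_iff _).1 (congrArg Subtype.val (Option.some.inj h))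

/-- The radius involves the sum of the norms, not the norm of the sum: whether w is in the support
depends on the patches at all its prefixes. -/
theorem Psi_congr_of_match {T₁ T₂ : PuncturedTilingSpace P} {w : List (PatchGen P K)} {r : ℝ}
    (h : Match T₁.1 T₂.1 (Metric.closedBall 0 r))
    (hr : K * tileRadius P + (w.map fun s => ‖s.val‖).sum ≤ r) :
    Psi P K T₁ w = Psi P K T₂ w := by
  have hle : ∀ w : List (PatchGen P K), ‖wordVal w‖ ≤ (w.map fun s => ‖s.val‖).sum := by
    intro w
    induction w with
    | nil => simp [wordVal_nil]
    | cons s w ih =>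
      rw [List.map_cons, List.sum_cons]
      exact (norm_add_le _ _).trans (by gcongr; exact ih)
  have hpatch : ∀ w : List (PatchGen P K), K * tileRadius P + ‖wordVal w‖ ≤ r →
      Psi P K T₁ w ≠ none → Psi P K T₂ w ≠ none → Psi P K T₁ w = Psi P K T₂ w := by
    intro w hw h₁ h₂
    obtain ⟨_, e₁⟩ := Psi_eq_some h₁
    obtain ⟨_, e₂⟩ := Psi_eq_some h₂
    rw [e₁, e₂]
    refine congrArg some (Subtype.ext ((match_neg_vadd_iff _).2 (h.mono ?_)))
    exact Metric.closedBall_subset_closedBall' (by simpa using hw)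
  induction w using List.reverseRecOn with
  | nil =>
    refine hpatch [] (by simpa [wordVal_nil] using hr) ?_ ?_ <;> simp [Psi_nil']
  | append_singleton w s ih =>
    have hr' := hr
    rw [List.map_append, List.sum_append] at hr'
    have ih' := ih (by
      have : 0 ≤ (List.map (fun s : PatchGen P K => ‖s.val‖) [s]).sum := by simp
      linarith)
    by_cases hs : Psi P K T₁ w = some s.1.1
    · obtain ⟨m₁, -, e₁⟩ := exists_mem_term_Psi_concat hs
      obtain ⟨m₂, -, e₂⟩ := exists_mem_term_Psi_concat (ih' ▸ hs)
      exact hpatch _ (by linarith [hle (w ++ [s])]) (by simp [e₁]) (by simp [e₂])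
    · rw [Psi_concat_of_ne hs, Psi_concat_of_ne (ih' ▸ hs)]

theorem match_of_dist_lt {T₁ T₂ : PuncturedTilingSpace P} {r : ℝ} (hr : 0 ≤ r)
    (h : dist T₁ T₂ < 2 ^ (-r)) : Match T₁.1 T₂.1 (Metric.closedBall 0 r) := by
  change tilingDist T₁.1 T₂.1 < _ at h
  unfold tilingDist at h
  split_ifs at h with heq
  · rw [heq]
    exact rfl
  · rw [Real.rpow_lt_rpow_left_iff one_lt_two, neg_lt_neg_iff] at h
    exact (mem_matchRadii_of_lt hr h).2

theorem dist_le_of_match {T₁ T₂ : PuncturedTilingSpace P} {r : ℝ} (hr : 0 ≤ r)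
    (h : Match T₁.1 T₂.1 (Metric.closedBall 0 r)) : dist T₁ T₂ ≤ 2 ^ (-r) := by
  change tilingDist T₁.1 T₂.1 ≤ _
  unfold tilingDist
  split_ifs with heq
  · positivity
  · rw [Real.rpow_le_rpow_left_iff one_lt_two, neg_le_neg_iff]
    exact le_csSup (bddAbove_matchRadii T₁.2.1.1.1.1 T₂.2.1.1.1.1 heq) ⟨hr, h⟩

theorem eventually_eq_at {M S : Type*} {Γ : Blueprint M S} (φ : Γ.ModelSpace) (w : List S) :
    ∀ᶠ φ' in nhds φ, φ'.1 w = φ.1 w := by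
  let _ : TopologicalSpace (Option M) := ⊥
  have : DiscreteTopology (Option M) := ⟨rfl⟩
  have hc : Continuous fun φ' : Γ.ModelSpace => φ'.1 w :=
    (continuous_apply w).comp continuous_induced_dom
  exact hc.continuousAt.eventually (p := fun m => m = φ.1 w) (by simp [nhds_discrete])

theorem continuous_modelOfTiling (K L : ℕ) :
    Continuous (modelOfTiling K L : PuncturedTilingSpace P → _) := by
  let _ : TopologicalSpace (Option (PatchState P K)) := ⊥
  refine continuous_induced_rng.2 (continuous_pi fun w => continuous_iff_continuousAt.2 fun T => ?_)
  refine Filter.EventuallyEq.continuousAt (y := Psi P K T w) ?_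
  set r : ℝ := max 0 (K * tileRadius P + (w.map fun s => ‖s.val‖).sum)
  filter_upwards [Metric.ball_mem_nhds T (ε := 2 ^ (-r)) (by positivity)] with T' hT'
  exact Psi_congr_of_match (match_of_dist_lt (le_max_left _ _) hT') (le_max_right _ _)

/-- Near a given model, the tilings of models match in any given ball. -/
theorem eventually_match (hd : 1 ≤ d) (hfin : P.Finite) (hP : IsPuncturedTileSet P) (hK : 6 ≤ K)
    (hL : 4 ≤ L) (T : PuncturedTilingSpace P) (r : ℝ) :
    ∀ᶠ φ in nhds (modelOfTiling K L T), ∀ T' : PuncturedTilingSpace P, modelOfTiling K L T' = φ →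
      Match T'.1 T.1 (Metric.closedBall 0 r) := by
  have h := isPatchModel hd hfin hP hK hL (isModel_Psi L T)
  have hρ := h.radius_pos
  have hKρ := h.six_mul_le
  -- Every point of the ball is within ρ of a net point, hence within 2ρ ≤ Kρ of the valuation of
  -- the chosen word. Agreement at these finitely many words is an open condition in the product
  -- topology.
  obtain ⟨Y, -, hYfin, hY⟩ := Metric.finite_approx_of_totallyBounded
    (isCompact_closedBall (0 : Eu d) r).totallyBounded _ hρ
  choose w hw hwy using h.exists_wordVal_near
  have hev := (Filter.eventually_all_finite hYfin).2 fun y _ =>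
    eventually_eq_at (modelOfTiling K L T) (w y)
  filter_upwards [hev] with φ hφ
  rintro T' rfl
  refine match_iff.2 fun t x hxt hx => ?_
  obtain ⟨y, hy, hxy⟩ := Set.mem_iUnion₂.1 (hY hx)
  refine (match_iff.1 (match_of_Psi_eq (hw y) (hφ y hy).symm) t x hxt ?_).symm
  have := dist_triangle_right x (wordVal (w y)) y
  have := hwy y
  have : dist x y < tileRadius P := hxy
  have : dist x (wordVal (w y)) ≤ K * tileRadius P := by linarith
  exact this

theorem bijective_modelOfTiling (hd : 1 ≤ d) (hfin : P.Finite) (hP : IsPuncturedTileSet P)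
    (hK : 6 ≤ K) (hL : 4 ≤ L) :
    Function.Bijective (modelOfTiling K L : PuncturedTilingSpace P → _) := by
  constructor
  · intro T T' hTT
    refine Subtype.ext (Set.ext fun t => ?_)
    have key : ∀ t, IsTile t → (t ∈ T.1 ↔ t ∈ T'.1) := by
      intro t ht
      obtain ⟨x, hx⟩ := ht.nonempty
      -- A property holding near a model holds at the model itself, so equal models have tilings
      -- matching in every ball.
      have := (eventually_match hd hfin hP hK hL T' ‖x‖).self_of_nhds T hTT
      exact match_iff.1 this t x hx (by simp)
    exact ⟨fun ht => (key t (T.2.1.1.1.1 t ht)).1 ht, fun ht => (key t (T'.2.1.1.1.1 t ht)).2 ht⟩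
  · intro φ
    have h := isPatchModel hd hfin hP hK hL φ.2
    exact ⟨h.tiling, Subtype.ext h.Psi_tiling⟩

/-- The space of punctured tilings is homeomorphic to the space of models of a patch blueprint of
sufficiently large parameters. -/
noncomputable def tilingHomeomorph (hd : 1 ≤ d) (hfin : P.Finite) (hP : IsPuncturedTileSet P)
    (hK : 6 ≤ K) (hL : 4 ≤ L) : PuncturedTilingSpace P ≃ₜ (patchBlueprint P K L).ModelSpace where
  toEquiv := Equiv.ofBijective _ (bijective_modelOfTiling hd hfin hP hK hL)
  continuous_toFun := continuous_modelOfTiling K L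
  continuous_invFun := by
    refine continuous_iff_continuousAt.2 fun φ => Metric.tendsto_nhds.2 fun ε hε => ?_
    set e := Equiv.ofBijective _ (bijective_modelOfTiling (P := P) hd hfin hP hK hL)
    have he : modelOfTiling K L (e.symm φ) = φ := e.apply_symm_apply φ
    obtain ⟨n, hn⟩ := exists_pow_lt_of_lt_one hε (by norm_num : (2⁻¹ : ℝ) < 1)
    have hev := eventually_match hd hfin hP hK hL (e.symm φ) n
    rw [he] at hev
    filter_upwards [hev] with φ' hφ'
    refine (dist_le_of_match n.cast_nonneg (hφ' _ (e.apply_symm_apply φ'))).trans_lt ?_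
    rwa [Real.rpow_neg zero_le_two, Real.rpow_natCast, ← inv_pow]

end GeomTiling

theorem mainTheorem5 (d : ℕ) (hd : 1 ≤ d) (P : Set (Set (GeomTiling.Eu d))) (hfin : P.Finite)
    (hP : GeomTiling.IsPuncturedTileSet P) (hFLC : GeomTiling.FLC P)
    (K L : ℕ) (hK : 117 ≤ K) (hL : 2 * K + 14 ≤ L) :
    ∃ e : GeomTiling.PuncturedTilingSpace P ≃ₜ (GeomTiling.patchBlueprint P K L).ModelSpace,
      ∀ T : GeomTiling.PuncturedTilingSpace P, (e T).1 = GeomTiling.Psi P K T :=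
  ⟨GeomTiling.tilingHomeomorph hd hfin hP (by omega) (by omega), fun _ => rfl⟩
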